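/- Let $N\ge 0$ and let $\mathcal U=\mathbb Z\langle u_1,\dots,u_N\rangle$ be the free associative ring, graded by $\deg u_i=1$; ideals are two-sided. Let $I_{\mathrm C}$ be the ideal generated by $u_b^2u_a+u_au_bu_a-u_bu_au_b-u_bu_a^2$ for $a<b$, and by $u_bu_cu_a+u_au_cu_b-u_bu_au_c-u_cu_au_b$ and $u_cu_bu_cu_a+u_bu_cu_au_c-u_cu_bu_au_c-u_bu_c^2u_a$ for $a<b<c$. Let $\mathcal U^*$ be the free $\mathbb Z$-module on the words in the alphabet $\{1,\dots,N\}$, with the pairing $\langle\cdot,\cdot\rangle:\mathcal U\times\mathcal U^*\to\mathbb Z$ for which noncommutative monomials and words are dual bases. Let $\mathcal U_{\ge0}$ and $\mathcal U^*_{\ge 0}$ be the sets of nonnegative integer combinations of monomials and of words, respectively, and for an ideal $I$ let $I^\perp=\{\gamma\in\mathcal U^*:\langle z,\gamma\rangle=0\text{ for all }z\in I\}$. Put $$e_k(\mathbf u)=\sum_{i_1>\cdots>i_k}u_{i_1}\cdots u_{i_k},\qquad h_\ell(\mathbf u)=\sum_{i_1\le\cdots\le i_\ell}u_{i_1}\cdots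 u_{i_\ell}$$ ($e_0=h_0=1$; $e_k=0$ for $k<0$ or $k>N$), and for $\gamma\in\mathcal U^*$ let $$F_\gamma(\mathbf x)=\Big\langle \prod_{j=1}^{\infty}\sum_{\ell\ge0}x_j^\ell h_\ell(\mathbf u),\ \gamma\Big\rangle\in\mathbb Z[[x_1,x_2,\dots]],$$ where the factors are multiplied from left to right, the $x_j$ commute with each other and with the $u_i$, and the pairing is taken coefficientwise. For a partition $\lambda$ with conjugate $\lambda'$ and $t=\lambda_1$, let $$\mathfrak J_\lambda(\mathbf u)=\sum_{\pi\in S_t}\operatorname{sgn}(\pi)\,e_{\lambda'_1+\pi(1)-1}(\mathbf u)\,e_{\lambda'_2+\pi(2)-2}(\mathbf u)\cdots e_{\lambda'_t+\pi(t)-t}(\mathbf u).$$ An element $f\in\mathcal U$ is $\mathbb Q$-monomial positive modulo $I$ if $mf\in\mathcal U_{\ge0}+I$ for some positive integer $m$. Let $s_\lambda(\mathbf x)$ denote the Schur functions; a finite $\mathbb Z$-linear combination of Schur functions is Schur positive if its coefficients are nonnegative. Theorem. Let $I\supseteq I_{\mathrm C}$ be a homogeneous ideal of $\mathcal U$. For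 every $\gamma\in I^\perp$, $F_\gamma(\mathbf x)$ can be written in a unique way as a finite $\mathbb Z$-linear combination of the Schur functions $s_\lambda(\mathbf x)$. The following are equivalent: (i) $F_\gamma(\mathbf x)$ is Schur positive for all $\gamma\in\mathcal U^*_{\ge0}\cap I^\perp$; (ii) $\mathfrak J_\lambda(\mathbf u)$ is $\mathbb Q$-monomial positive modulo $I$ for all partitions $\lambda$. Moreover, for each partition $\lambda$ separately, the coefficient of $s_\lambda(\mathbf x)$ in $F_\gamma(\mathbf x)$ is nonnegative for all $\gamma\in\mathcal U^*_{\ge0}\cap I^\perp$ if and only if $\mathfrak J_\lambda(\mathbf u)$ is $\mathbb Q$-monomial positive modulo $I$. -/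

import Mathlib

namespace NCSchur

noncomputable section

/-- The free associative ring `𝒰 = ℤ⟨u_1, …, u_N⟩`: integer combinations of words in the alphabet
`Fin N`, multiplied by concatenation. The letter `i : Fin N` stands for the index `i + 1`. -/
abbrev FreeRing (N : ℕ) : Type := MonoidAlgebra ℤ (FreeMonoid (Fin N))

/-- The free `ℤ`-module `𝒰^*` spanned by the words in the alphabet `Fin N`. -/
abbrev WordModule (N : ℕ) : Type := FreeMonoid (Fin N) →₀ ℤ

/-- The noncommutative monomial `u_w` of a word `w`. -/
def mono {N : ℕ} (w : FreeMonoid (Fin N)) : FreeRing N := MonoidAlgebra.of ℤ _ w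

/-- The generator `u_i`. -/
def u {N : ℕ} (i : Fin N) : FreeRing N := mono (FreeMonoid.of i)

/-- The pairing `⟨f, γ⟩` for which monomials and words are dual bases. -/
def pairing {N : ℕ} (f : FreeRing N) (γ : WordModule N) : ℤ :=
  γ.sum fun w c => f.coeff w * c

/-- The degree `d` homogeneous component of `f`, for the grading with `deg u_i = 1`. -/
def component {N : ℕ} (d : ℕ) (f : FreeRing N) : FreeRing N :=
  MonoidAlgebra.ofCoeff (f.coeff.filter fun w => w.length = d)

/-- A two-sided ideal is homogeneous if it contains all homogeneous components of each of its
elements. -/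
def IsHomogeneousIdeal {N : ℕ} (I : TwoSidedIdeal (FreeRing N)) : Prop :=
  ∀ f ∈ I, ∀ d : ℕ, component d f ∈ I

/-- The ideal `I_C`, given by its generators. -/
def idealC (N : ℕ) : TwoSidedIdeal (FreeRing N) :=
  TwoSidedIdeal.span
    ({f | ∃ a b : Fin N, a < b ∧
        f = u b ^ 2 * u a + u a * u b * u a - u b * u a * u b - u b * u a ^ 2} ∪
     {f | ∃ a b c : Fin N, a < b ∧ b < c ∧
        f = u b * u c * u a + u a * u c * u b - u b * u a * u c - u c * u a * u b} ∪
     {f | ∃ a b c : Fin N, a < b ∧ b < c ∧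
        f = u c * u b * u c * u a + u b * u c * u a * u c
          - u c * u b * u a * u c - u b * u c ^ 2 * u a})

/-- The orthogonal complement `I^⊥ ⊆ 𝒰^*`. -/
def perp {N : ℕ} (I : TwoSidedIdeal (FreeRing N)) : Set (WordModule N) :=
  {γ | ∀ z ∈ I, pairing z γ = 0}

/-- The cone `𝒰^*_{≥ 0}` of nonnegative integer combinations of words. -/
def wordCone (N : ℕ) : Set (WordModule N) := {γ | ∀ w, 0 ≤ γ w}

/-- The cone `𝒰_{≥ 0}` of nonnegative integer combinations of monomials. -/
def monomialCone (N : ℕ) : Set (FreeRing N) := {f | ∀ w, 0 ≤ f.coeff w}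

/-- `f` is `ℤ`-monomial positive modulo `I`: it lies in `𝒰_{≥ 0} + I`. -/
def IsZMonomialPositive {N : ℕ} (I : TwoSidedIdeal (FreeRing N)) (f : FreeRing N) : Prop :=
  ∃ p ∈ monomialCone N, ∃ z ∈ I, f = p + z

/-- `f` is `ℚ`-monomial positive modulo `I`: some positive integer multiple of `f` is
`ℤ`-monomial positive modulo `I`. -/
def IsQMonomialPositive {N : ℕ} (I : TwoSidedIdeal (FreeRing N)) (f : FreeRing N) : Prop :=
  ∃ m : ℕ, 0 < m ∧ IsZMonomialPositive I (m • f)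

open Classical in
/-- The noncommutative elementary symmetric function: the sum of `u_{i_1} ⋯ u_{i_k}` over
`i_1 > ⋯ > i_k`. It is `1` for `k = 0` and `0` for `k > N`. -/
def elemNat (N k : ℕ) : FreeRing N :=
  ∑ f : Fin k → Fin N with StrictAnti f, mono (FreeMonoid.ofList (List.ofFn f))

/-- `e_k(𝐮)` for an integer `k`, with `e_k(𝐮) = 0` for `k < 0`. -/
def elem (N : ℕ) (k : ℤ) : FreeRing N := if 0 ≤ k then elemNat N k.toNat else 0

open Classical in
/-- The noncommutative complete homogeneous symmetric function `h_ℓ(𝐮)`: the sum of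
`u_{i_1} ⋯ u_{i_ℓ}` over `i_1 ≤ ⋯ ≤ i_ℓ`. It is `1` for `ℓ = 0`. -/
def homog (N l : ℕ) : FreeRing N :=
  ∑ f : Fin l → Fin N with Monotone f, mono (FreeMonoid.ofList (List.ofFn f))

/-- The noncommutative Schur function `𝔍_λ(𝐮)`, by the noncommutative Kostka-Naegelsbach
determinantal formula. Here `t = λ_1 = μ.rowLen 0` and `λ'_i = μ.colLen i`. -/
def ncSchur (N : ℕ) (μ : YoungDiagram) : FreeRing N :=
  ∑ π : Equiv.Perm (Fin (μ.rowLen 0)),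
    (Equiv.Perm.sign π : ℤ) •
      (List.ofFn fun i : Fin (μ.rowLen 0) =>
        elem N ((μ.colLen i : ℤ) + ((π i : ℕ) : ℤ) - ((i : ℕ) : ℤ))).prod

/-- The power series `H(x_j) = ∑_ℓ x_j^ℓ h_ℓ(𝐮)` in `𝒰[[x_0, x_1, …]]`. -/
def genH (N j : ℕ) : MvPowerSeries ℕ (FreeRing N) :=
  fun α => if α = Finsupp.single j (α j) then homog N (α j) else 0

/-- The finite product `H(x_0) H(x_1) ⋯ H(x_{n-1})`, multiplied from left to right. -/
def partialCauchy (N n : ℕ) : MvPowerSeries ℕ (FreeRing N) :=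
  ((List.range n).map (genH N)).prod

/-- The noncommutative Cauchy product `Ω(𝐱, 𝐮) = H(x_0) H(x_1) H(x_2) ⋯`. The coefficient of
`x^α` is that of the finite product over those `j` up to the largest index in the support of `α`;
further factors do not change it, see `coeff_cauchyProduct`. -/
def cauchyProduct (N : ℕ) : MvPowerSeries ℕ (FreeRing N) :=
  fun α => MvPowerSeries.coeff α (partialCauchy N (α.support.sup id + 1))

theorem coeff_partialCauchy (N n : ℕ) (α : ℕ →₀ ℕ) :
    MvPowerSeries.coeff α (partialCauchy N n) =
      if α.support ⊆ Finset.range n then ((List.range n).map fun j => homog N (α j)).prod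
      else 0 := by
  classical
  induction n generalizing α with
  | zero =>
    simp [partialCauchy, MvPowerSeries.coeff_one]
  | succ n ih =>
    have hP : partialCauchy N (n + 1) = partialCauchy N n * genH N n := by
      simp [partialCauchy, List.range_succ]
    rw [hP, MvPowerSeries.coeff_mul]
    have hH : ∀ b : ℕ →₀ ℕ, MvPowerSeries.coeff b (genH N n) =
        if b = Finsupp.single n (b n) then homog N (b n) else 0 := fun b => rfl
    rw [Finset.sum_eq_single (α.erase n, Finsupp.single n (α n))]
    · rw [ih, hH]
      have h1 : ((α.erase n).support ⊆ Finset.range n) ↔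
          (α.support ⊆ Finset.range (n + 1)) := by
        simp only [Finset.subset_iff, Finsupp.support_erase, Finset.mem_erase, Finset.mem_range]
        constructor
        · intro h x hx
          by_cases hxn : x = n
          · omega
          · have := h ⟨hxn, hx⟩; omega
        · intro h x hx
          have := h hx.2; omega
      simp only [h1, Finsupp.single_eq_same, if_true]
      split_ifs
      · rw [List.range_succ, List.map_append, List.prod_append]
        congr 1
        · congr 1
          apply List.map_congr_left
          intro j hj
          rw [Finsupp.erase_ne (by have := List.mem_range.1 hj; omega)]
        · simp
      · simp
    · rintro ⟨a, b⟩ hab hne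
      rw [Finset.HasAntidiagonal.mem_antidiagonal] at hab
      simp only at hab
      rw [ih, hH]
      split_ifs with ha hb
      · exfalso
        apply hne
        have han : a n = 0 := by
          by_contra h
          have := Finset.mem_range.1 (ha (Finsupp.mem_support_iff.2 h)); omega
        have hbn : b n = α n := by rw [← hab]; simp [han]
        rw [hbn] at hb
        change b = Finsupp.single n (α n) at hb
        have hae : a = α.erase n := by
          ext j
          by_cases hj : j = n
          · subst hj; simp [han]
          · rw [Finsupp.erase_ne hj, ← hab, hb]
            simp [Finsupp.single_apply, Ne.symm hj]
        rw [Prod.mk.injEq]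
        exact ⟨hae, hb⟩
      · simp
      · simp
      · simp
    · intro h
      exact absurd (Finset.HasAntidiagonal.mem_antidiagonal.2 (Finsupp.erase_add_single n α)) h

/-- The coefficients of the finite products stabilize to those of the Cauchy product. -/
theorem coeff_cauchyProduct (N n : ℕ) (α : ℕ →₀ ℕ) (hα : α.support ⊆ Finset.range n) :
    MvPowerSeries.coeff α (partialCauchy N n) = MvPowerSeries.coeff α (cauchyProduct N) := by
  have key : ∀ m k : ℕ, α.support ⊆ Finset.range m →
      ((List.range (m + k)).map fun j => homog N (α j)).prod =
        ((List.range m).map fun j => homog N (α j)).prod := by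
    intro m k hm
    have h0 : homog N 0 = 1 := by
      classical
      rw [homog, Finset.filter_true_of_mem (fun f _ => Subsingleton.monotone f)]
      simp [mono, MonoidAlgebra.one_def]
    induction k with
    | zero => rfl
    | succ k ih =>
      have hz : α (m + k) = 0 := by
        by_contra h
        have := Finset.mem_range.1 (hm (Finsupp.mem_support_iff.2 h)); omega
      rw [← Nat.add_assoc, List.range_succ, List.map_append, List.prod_append, ih]
      simp [hz, h0]
  have hs : α.support ⊆ Finset.range (α.support.sup id + 1) := fun x hx =>
    Finset.mem_range.2 (Nat.lt_succ_of_le (Finset.le_sup (f := id) hx))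
  change _ = MvPowerSeries.coeff α (partialCauchy N (α.support.sup id + 1))
  rw [coeff_partialCauchy, coeff_partialCauchy, if_pos hα, if_pos hs]
  rcases le_total n (α.support.sup id + 1) with h | h
  · obtain ⟨k, hk⟩ := Nat.exists_eq_add_of_le h
    rw [hk, key n k hα]
  · obtain ⟨k, hk⟩ := Nat.exists_eq_add_of_le h
    rw [hk, key _ k hs]

/-- The power series `F_γ(𝐱) = ⟨Ω(𝐱, 𝐮), γ⟩`, the pairing being taken coefficientwise. -/
def F {N : ℕ} (γ : WordModule N) : MvPowerSeries ℕ ℤ :=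
  fun α => pairing (MvPowerSeries.coeff α (cauchyProduct N)) γ

/-- The Schur function `s_λ(𝐱)` in `x_0, x_1, …`: the generating function of semistandard Young
tableaux. The coefficient of `x^α` is the number of semistandard tableaux of shape `λ` in which
each `i` occurs exactly `α i` times. -/
def schur (μ : YoungDiagram) : MvPowerSeries ℕ ℤ :=
  fun α => (Nat.card {T : SemistandardYoungTableau μ //
    ∀ i : ℕ, (μ.cells.filter fun c => T c.1 c.2 = i).card = α i} : ℤ)

/-- `c` is a Schur expansion of `G`: `G = ∑_λ c_λ s_λ(𝐱)`, a finite sum. -/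
def IsSchurExpansion (G : MvPowerSeries ℕ ℤ) (c : YoungDiagram →₀ ℤ) : Prop :=
  G = c.sum fun μ a => a • schur μ

/-- `G` is Schur positive: it is a finite combination of Schur functions with nonnegative
coefficients. -/
def IsSchurPositive (G : MvPowerSeries ℕ ℤ) : Prop :=
  ∃ c : YoungDiagram →₀ ℤ, IsSchurExpansion G c ∧ ∀ μ, 0 ≤ c μ

end

end NCSchur

/-!
Modulo `I_C` the noncommutative elementary symmetric functions `e_k(𝐮)` commute with each other.
Write `c_{ij} = [u_i, u_j]`. The generators of `I_C` say exactly that `u_b c_{ab} = c_{ab} u_a`,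
that `u_b` commutes with `c_{ac}`, and that `c_{bc} c_{ac} = 0`, for `a < b < c`. From these one
gets `(1 + x u_n) [E(x), u_n] = x (∑ c_{in}) E(x)` for the generating function `E(x)` of the `e_k`
in smaller variables (`commutator_seqElem`), and adjoining the variable `u_n` then preserves
commutativity (`seqElem_commute`). Since `H(x) E(-x) = 1`, the `h_l(𝐮)` lie in the commutative
ring generated by the images of the `e_k(𝐮)`.

In a commutative ring, the determinants `𝔍_λ` satisfy the Pieri rule `homog_mul_schurDet`. Summing
over the ways to add `l` cells in distinct columns means shifting `l` rows of the determinant;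
this is the same as shifting `l` columns, where all but one choice yields two equal columns, and
the remaining matrix is block triangular with blocks of determinants `𝔍_λ` and `h_l`. Removing the
largest entry from semistandard tableaux shows that Kostka numbers obey the matching recursion
(`kostka_eq_sum`), so `h_α = ∑_λ K_{λα} 𝔍_λ`, that is, `F_γ = ∑_λ ⟨𝔍_λ, γ⟩ s_λ` for `γ ∈ I^⊥`
(`isSchurExpansion_schurCoeff`). Schur functions are linearly independent by triangularity of the
Kostka numbers, so the coefficient of `s_λ` is `⟨𝔍_λ, γ⟩`.

It remains to see that `⟨𝔍_λ, γ⟩ ≥ 0` on all of `𝒰^*_{≥ 0} ∩ I^⊥` exactly when `𝔍_λ` is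
`ℚ`-monomial positive modulo `I`. As `𝔍_λ` and `I` are homogeneous, this takes place in the
finite-dimensional space of words of length `|λ|`, modulo the span of `I`, and is Farkas' lemma
over `ℚ` followed by clearing denominators (`isQMonomialPositive_iff`).
-/

namespace NCSchur

/-! ### Commuting noncommutative elementary symmetric functions -/

section Sequences

variable {R : Type*} [Ring R]

/-- The elementary symmetric function of degree `k` in the noncommuting elements
`v 0, …, v (m - 1)`, each product written with decreasing indices. It is defined by the recursion
that splits off the largest index. -/
def seqElem (v : ℕ → R) : ℕ → ℕ → R
  | _, 0 => 1
  | 0, _ + 1 => 0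
  | m + 1, k + 1 => seqElem v m (k + 1) + v m * seqElem v m k

/-- The complete homogeneous symmetric function of degree `l` in the noncommuting elements
`v 0, …, v (m - 1)`, each product written with weakly increasing indices. -/
def seqHomog (v : ℕ → R) : ℕ → ℕ → R
  | _, 0 => 1
  | 0, _ + 1 => 0
  | m + 1, l + 1 => seqHomog v m (l + 1) + seqHomog v (m + 1) l * v m

@[simp] theorem seqElem_zero_right (v : ℕ → R) (m : ℕ) : seqElem v m 0 = 1 := by
  cases m <;> rfl

@[simp] theorem seqElem_zero_succ (v : ℕ → R) (k : ℕ) : seqElem v 0 (k + 1) = 0 := rfl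

theorem seqElem_succ_succ (v : ℕ → R) (m k : ℕ) :
    seqElem v (m + 1) (k + 1) = seqElem v m (k + 1) + v m * seqElem v m k := rfl

@[simp] theorem seqHomog_zero_right (v : ℕ → R) (m : ℕ) : seqHomog v m 0 = 1 := by
  cases m <;> rw [seqHomog]

@[simp] theorem seqHomog_zero_succ (v : ℕ → R) (k : ℕ) : seqHomog v 0 (k + 1) = 0 := by
  rw [seqHomog]

theorem seqHomog_succ_succ (v : ℕ → R) (m l : ℕ) :
    seqHomog v (m + 1) (l + 1) = seqHomog v m (l + 1) + seqHomog v (m + 1) l * v m := by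
  rw [seqHomog]

/-- The relations given by the generators of `I_C`, rewritten with the commutators
`[v a, v b] = v a * v b - v b * v a`. -/
structure SatisfiesRelationsC (v : ℕ → R) : Prop where
  pair : ∀ a b, a < b → v b * (v a * v b - v b * v a) = (v a * v b - v b * v a) * v a
  comm : ∀ a b c, a < b → b < c → v b * (v a * v c - v c * v a) = (v a * v c - v c * v a) * v b
  mul_eq_zero : ∀ a b c, a < b → b < c →
    (v b * v c - v c * v b) * (v a * v c - v c * v a) = 0

/-- If `x` kills the commutators `[v a, u]` from the left, it kills `[e_k, u]`: in the expansion of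
the latter by the Leibniz rule, the factors to the left of `[v a, u]` commute with it. -/
theorem mul_commutator_seqElem_eq_zero (v : ℕ → R) (u x : R) (m k : ℕ)
    (hc : ∀ a b, a < b → b < m → v b * (v a * u - u * v a) = (v a * u - u * v a) * v b)
    (hx : ∀ a < m, x * (v a * u - u * v a) = 0) :
    x * (seqElem v m k * u - u * seqElem v m k) = 0 := by
  induction m generalizing x k with
  | zero => cases k <;> simp
  | succ m ih =>
    have hc' : ∀ a b, a < b → b < m → v b * (v a * u - u * v a) = (v a * u - u * v a) * v b :=
      fun a b h h' => hc a b h (by omega)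
    cases k with
    | zero => simp
    | succ k =>
      have h1 := ih x (k + 1) hc' (fun a ha => hx a (by omega))
      have h2 := ih (x * v m) k hc' (fun a ha => by
        rw [mul_assoc, hc a m ha (by omega), ← mul_assoc, hx a (by omega), zero_mul])
      have h3 := hx m (by omega)
      rw [seqElem_succ_succ]
      calc _ = x * (seqElem v m (k + 1) * u - u * seqElem v m (k + 1))
            + x * (v m * u - u * v m) * seqElem v m k
            + x * v m * (seqElem v m k * u - u * seqElem v m k) := by noncomm_ring
        _ = 0 := by rw [h1, h2, h3]; simp

/-- The commutator `[E(x), u]` of the generating function of the `e_k` satisfies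
`(1 + x u) [E(x), u] = x (∑ [v i, u]) E(x)`. -/
theorem commutator_seqElem (v : ℕ → R) (hv : SatisfiesRelationsC v) (n m k : ℕ) (hm : m ≤ n) :
    (seqElem v m (k + 1) * v n - v n * seqElem v m (k + 1)) +
      v n * (seqElem v m k * v n - v n * seqElem v m k) =
    (∑ i ∈ Finset.range m, (v i * v n - v n * v i)) * seqElem v m k := by
  induction m generalizing k with
  | zero => cases k <;> simp
  | succ m ih =>
    have hmn : m < n := by omega
    have hcomm : v m * (∑ i ∈ Finset.range m, (v i * v n - v n * v i)) =
        (∑ i ∈ Finset.range m, (v i * v n - v n * v i)) * v m := by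
      rw [Finset.mul_sum, Finset.sum_mul]
      exact Finset.sum_congr rfl fun i hi => hv.comm i m n (Finset.mem_range.1 hi) hmn
    have hp := hv.pair m n hmn
    have hz := fun k => mul_commutator_seqElem_eq_zero v (v n) (v m * v n - v n * v m) m k
      (fun a b h h' => hv.comm a b n h (by omega)) (fun a ha => hv.mul_eq_zero a m n ha hmn)
    rw [Finset.sum_range_succ]
    cases k with
    | zero =>
      have := ih 0 (by omega)
      simp only [seqElem_succ_succ, seqElem_zero_right, mul_one] at this ⊢
      rw [← this]
      noncomm_ring
    | succ k =>
      have i1 := ih (k + 1) (by omega)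
      have i0 := ih k (by omega)
      have hz := hz k
      set C := ∑ i ∈ Finset.range m, (v i * v n - v n * v i)
      simp only [seqElem_succ_succ]
      generalize seqElem v m (k + 1 + 1) = e2 at *
      generalize seqElem v m (k + 1) = e1 at *
      generalize seqElem v m k = e0 at *
      generalize v n = u at *
      generalize v m = a at *
      calc _ = ((e2 * u - u * e2) + u * (e1 * u - u * e1)) + (a * u - u * a) * e1
            + u * (a * u - u * a) * e0
            + (a * ((e1 * u - u * e1) + u * (e0 * u - u * e0))
              - (a * u - u * a) * (e0 * u - u * e0)) := by noncomm_ring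
        _ = C * e1 + (a * u - u * a) * e1 + (a * u - u * a) * a * e0 + a * (C * e0) := by
            rw [i1, i0, hp, hz, sub_zero]
        _ = (C + (a * u - u * a)) * (e1 + a * e0) := by
            rw [← mul_assoc, hcomm]; noncomm_ring

/-- The noncommutative elementary symmetric functions commute with each other. -/
theorem seqElem_commute (v : ℕ → R) (hv : SatisfiesRelationsC v) (m k l : ℕ) :
    seqElem v m k * seqElem v m l = seqElem v m l * seqElem v m k := by
  induction m generalizing k l with
  | zero => cases k <;> cases l <;> simp
  | succ m ih =>
    cases k with
    | zero => simp
    | succ k =>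
      cases l with
      | zero => simp
      | succ l =>
        have hk := commutator_seqElem v hv m m k le_rfl
        have hl := commutator_seqElem v hv m m l le_rfl
        simp only [seqElem_succ_succ]
        have h1 := ih (k + 1) (l + 1)
        have h2 := ih k (l + 1)
        have h3 := ih (k + 1) l
        have h4 := ih k l
        set C := ∑ i ∈ Finset.range m, (v i * v m - v m * v i)
        generalize seqElem v m (k + 1) = k1 at *
        generalize seqElem v m k = k0 at *
        generalize seqElem v m (l + 1) = l1 at *
        generalize seqElem v m l = l0 at *
        generalize v m = u at *
        calc _ = k1 * l1 + u * (k1 * l0) + u * (k0 * l1) + u * u * (k0 * l0)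
              + ((k1 * u - u * k1) + u * (k0 * u - u * k0)) * l0 := by noncomm_ring
          _ = l1 * k1 + u * (l0 * k1) + u * (l1 * k0) + u * u * (l0 * k0) + C * (l0 * k0) := by
              rw [hk, mul_assoc C, h1, h2, h3, h4]
          _ = l1 * k1 + u * (l0 * k1) + u * (l1 * k0) + u * u * (l0 * k0)
              + ((l1 * u - u * l1) + u * (l0 * u - u * l0)) * k0 := by rw [hl, mul_assoc C]
          _ = _ := by noncomm_ring

/-- The relation `H(x) E(-x) = 1` between the generating functions. -/
theorem sum_seqHomog_mul_seqElem (v : ℕ → R) (m n : ℕ) :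
    ∑ p ∈ Finset.HasAntidiagonal.antidiagonal n, seqHomog v m p.1 * ((-1) ^ p.2 * seqElem v m p.2) =
      if n = 0 then 1 else 0 := by
  suffices h : (PowerSeries.mk (seqHomog v m)) * (PowerSeries.mk fun k => (-1) ^ k * seqElem v m k)
      = 1 by
    have := congrArg (PowerSeries.coeff n) h
    rw [PowerSeries.coeff_mul, PowerSeries.coeff_one] at this
    simpa using this
  induction m with
  | zero =>
    have h1 : PowerSeries.mk (seqHomog v 0) = 1 := by
      ext (_ | k) <;> simp [PowerSeries.coeff_one]
    have h2 : (PowerSeries.mk fun k => (-1) ^ k * seqElem v 0 k) = 1 := by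
      ext (_ | k) <;> simp [PowerSeries.coeff_one]
    rw [h1, h2, one_mul]
  | succ m ih =>
    have h1 : PowerSeries.mk (seqHomog v (m + 1)) * (1 - PowerSeries.C (v m) * PowerSeries.X) =
        PowerSeries.mk (seqHomog v m) := by
      ext (_ | k)
      · simp [mul_sub, ← mul_assoc]
      · rw [mul_sub, ← mul_assoc, map_sub, PowerSeries.coeff_succ_mul_X]
        simp [seqHomog_succ_succ]
    have h2 : (PowerSeries.mk fun k => (-1) ^ k * seqElem v (m + 1) k) =
        (1 - PowerSeries.C (v m) * PowerSeries.X) *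
          PowerSeries.mk fun k => (-1) ^ k * seqElem v m k := by
      ext (_ | k)
      · simp [sub_mul, mul_assoc]
      · rw [sub_mul, mul_assoc, map_sub, PowerSeries.coeff_C_mul, PowerSeries.coeff_succ_X_mul]
        simp only [PowerSeries.coeff_mk, one_mul, seqElem_succ_succ, mul_add, pow_succ]
        rcases neg_one_pow_eq_or R k with h | h <;> rw [h] <;> noncomm_ring
    rw [h2, ← mul_assoc, h1, ih]

end Sequences

/-! ### Kostka–Naegelsbach determinants -/

section Determinants

variable {A : Type*} [CommRing A]

/-- The Kostka–Naegelsbach determinant `det (e_{a_i + j - i})` of size `n` for a sequence `a` of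
column lengths. -/
def kostkaDet (e : ℤ → A) (n : ℕ) (a : ℕ → ℕ) : A :=
  Matrix.det (Matrix.of fun i j : Fin n => e ((a i : ℤ) + j - i))

theorem det_eq_mul_of_lower_left_zero {t l : ℕ} (M : Matrix (Fin (t + l)) (Fin (t + l)) A)
    (h : ∀ (i : Fin l) (j : Fin t), M (Fin.natAdd t i) (Fin.castAdd l j) = 0) :
    M.det = (Matrix.of fun i j : Fin t => M (Fin.castAdd l i) (Fin.castAdd l j)).det *
      (Matrix.of fun i j : Fin l => M (Fin.natAdd t i) (Fin.natAdd t j)).det := by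
  rw [← Matrix.det_fromBlocks_zero₂₁ _
    (Matrix.of fun (i : Fin t) (j : Fin l) => M (Fin.castAdd l i) (Fin.natAdd t j)),
    ← Matrix.det_reindex_self finSumFinEquiv.symm M]
  congr 1
  ext (i | i) (j | j) <;> simp [h]

theorem det_unitriangular (e : ℤ → A) (he0 : e 0 = 1) (hneg : ∀ k < 0, e k = 0) (l : ℕ) :
    (Matrix.of fun i j : Fin l => e ((j : ℤ) - i)).det = 1 := by
  rw [Matrix.det_of_isUpperTriangular]
  · simp [he0]
  · intro i j hij
    exact hneg _ (by simp only [id] at hij; have : (j : ℕ) < i := hij; omega)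

theorem kostkaDet_add (e : ℤ → A) (he0 : e 0 = 1) (hneg : ∀ k < 0, e k = 0) (t l : ℕ)
    (a : ℕ → ℕ) (ha : ∀ i, t ≤ i → a i = 0) : kostkaDet e (t + l) a = kostkaDet e t a := by
  rw [kostkaDet, det_eq_mul_of_lower_left_zero]
  · have h1 : (Matrix.of fun i j : Fin l =>
        (Matrix.of fun i j : Fin (t + l) => e ((a i : ℤ) + j - i))
          (Fin.natAdd t i) (Fin.natAdd t j)) = Matrix.of fun i j : Fin l => e ((j : ℤ) - i) := by
      ext i j
      simp [ha]
    rw [h1, det_unitriangular e he0 hneg, mul_one, kostkaDet]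
    rfl
  · intro i j
    have := j.2
    simp only [Matrix.of_apply]
    rw [ha _ (by simp)]
    exact hneg _ (by simp; omega)

/-- Summed over all `l`-element subsets, shifting rows of a determinant gives the same result as
shifting columns. -/
theorem sum_det_shift_rows (n l : ℕ) (g : Fin n → ℕ → A) :
    ∑ B ∈ Finset.powersetCard l (Finset.univ : Finset (Fin n)),
      (Matrix.of fun i j : Fin n => g i (j + if i ∈ B then 1 else 0)).det =
    ∑ C ∈ Finset.powersetCard l (Finset.univ : Finset (Fin n)),
      (Matrix.of fun i j : Fin n => g i (j + if j ∈ C then 1 else 0)).det := by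
  simp only [Matrix.det_apply, Matrix.of_apply]
  rw [Finset.sum_comm, Finset.sum_comm (t := (Finset.univ : Finset (Equiv.Perm (Fin n))))]
  refine Finset.sum_congr rfl fun σ _ => ?_
  refine Finset.sum_nbij' (fun B => B.map σ.symm.toEmbedding) (fun C => C.map σ.toEmbedding)
    ?_ ?_ ?_ ?_ ?_
  · intro B hB
    simpa [Finset.mem_powersetCard] using hB
  · intro B hB
    simpa [Finset.mem_powersetCard] using hB
  · intro B _
    ext x; simp
  · intro B _
    ext x; simp
  · intro B _
    congr 1
    refine Finset.prod_congr rfl fun i _ => ?_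
    congr 3
    simp

theorem sum_det_shift_cols (t l : ℕ) (g : Fin (t + l) → ℕ → A) :
    ∑ C ∈ Finset.powersetCard l (Finset.univ : Finset (Fin (t + l))),
      (Matrix.of fun i j : Fin (t + l) => g i (j + if j ∈ C then 1 else 0)).det =
    (Matrix.of fun i j : Fin (t + l) => g i (j + if t ≤ (j : ℕ) then 1 else 0)).det := by
  have hcard : (Finset.univ.filter fun j : Fin (t + l) => t ≤ (j : ℕ)).card = l := by
    have : (Finset.univ.filter fun j : Fin (t + l) => t ≤ (j : ℕ)) =
        Finset.univ.map (Fin.natAddEmb t) := by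
      ext j
      simp only [Finset.mem_filter, Finset.mem_univ, true_and, Finset.mem_map, Fin.natAddEmb_apply]
      constructor
      · intro h
        exact ⟨⟨j - t, by omega⟩, by ext; simp; omega⟩
      · rintro ⟨i, rfl⟩
        simp
    rw [this]; simp
  rw [Finset.sum_eq_single (Finset.univ.filter fun j : Fin (t + l) => t ≤ (j : ℕ))]
  · simp
  · intro C hC hne
    rw [Finset.mem_powersetCard] at hC
    -- a subset other than the last `l` columns is not upward closed
    obtain ⟨j, hj, j', hjj', hj'⟩ : ∃ j ∈ C, ∃ j' : Fin (t + l), (j' : ℕ) = j + 1 ∧ j' ∉ C := by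
      by_contra! hcl
      have hup : ∀ j ∈ C, ∀ k : ℕ, (j : ℕ) ≤ k → ∀ hk : k < t + l, (⟨k, hk⟩ : Fin (t + l)) ∈ C := by
        intro j hj k hjk
        induction k, hjk using Nat.le_induction with
        | base => intro _; exact hj
        | succ k _ ih => intro hk; exact hcl _ (ih (by omega)) _ rfl
      apply hne
      refine Finset.eq_of_subset_of_card_le ?_ (by rw [hcard, hC.2])
      intro j hj
      simp only [Finset.mem_filter, Finset.mem_univ, true_and]
      by_contra hlt
      have hlt' : (j : ℕ) < t := by omega
      have hsub : (insert j (Finset.univ.filter fun j : Fin (t + l) => t ≤ (j : ℕ))) ⊆ C := by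
        intro k hk
        rcases Finset.mem_insert.1 hk with rfl | hk
        · exact hj
        · have := (Finset.mem_filter.1 hk).2
          exact hup j hj k (by omega) k.2
      have := Finset.card_le_card hsub
      rw [Finset.card_insert_of_notMem (by simpa using hlt'), hcard, hC.2] at this
      omega
    apply Matrix.det_zero_of_column_eq (i := j) (j := j')
    · intro h; rw [h] at hjj'; omega
    · intro k
      simp [hj, hj', hjj']
  · intro h
    exact absurd (Finset.mem_powersetCard.2 ⟨Finset.subset_univ _, hcard⟩) h

/-- The complete homogeneous symmetric functions as determinants in the elementary ones. -/
theorem det_eq_homog (e : ℤ → A) (h : ℕ → A) (he0 : e 0 = 1) (hneg : ∀ k < 0, e k = 0)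
    (hh : ∀ n, ∑ p ∈ Finset.HasAntidiagonal.antidiagonal n, h p.1 * ((-1) ^ p.2 * e p.2) =
      if n = 0 then 1 else 0) (l : ℕ) :
    (Matrix.of fun i j : Fin l => e (1 + (j : ℤ) - i)).det = h l := by
  cases l with
  | zero => simpa [he0] using (hh 0).symm
  | succ l =>
    set M : Matrix (Fin (l + 1)) (Fin (l + 1)) A := Matrix.of fun i j => e (1 + (j : ℤ) - i)
    -- the combination of columns given by the `h`'s has a single nonzero entry
    let c : Fin (l + 1) → A := fun j => (-1) ^ (l - j : ℕ) * h (l - j)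
    have h0 : h 0 = 1 := by simpa [he0] using hh 0
    have hdet := Matrix.det_updateCol_sum M (Fin.last l) c
    have hcol : (fun k => ∑ i, c i • M k i) =
        fun k => if k = 0 then (-1) ^ l * h (l + 1) else 0 := by
      funext k
      have hS : ∀ n : ℕ, 0 < n →
          ∑ m ∈ Finset.range (n + 1), (-1) ^ m * h m * e ((n : ℤ) - m) = 0 := by
        intro n hn
        have hn' := hh n
        rw [if_neg hn.ne', Finset.Nat.sum_antidiagonal_eq_sum_range_succ_mk] at hn'
        rw [← mul_zero ((-1) ^ n), ← hn', Finset.mul_sum]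
        refine Finset.sum_congr rfl fun m hm => ?_
        have hmn : m ≤ n := by simpa [Nat.lt_succ_iff] using hm
        obtain ⟨d, rfl⟩ := Nat.exists_eq_add_of_le hmn
        have hd : (-1 : A) ^ d * (-1) ^ d = 1 := by rw [← mul_pow]; simp
        simp only [Nat.add_sub_cancel_left, Nat.cast_add, add_sub_cancel_left, pow_add]
        linear_combination (-((-1) ^ m * h m * e d)) * hd
      have hsum : ∑ i, c i • M k i =
          ∑ m ∈ Finset.range (l + 1), (-1) ^ m * h m * e ((l : ℤ) + 1 - k - m) := by
        rw [← Finset.sum_range_reflect,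
          ← Fin.sum_univ_eq_sum_range
            (fun m => (-1) ^ (l + 1 - 1 - m) * h (l + 1 - 1 - m) *
              e ((l : ℤ) + 1 - k - (l + 1 - 1 - m : ℕ)))]
        refine Finset.sum_congr rfl fun i _ => ?_
        simp only [c, M, Matrix.of_apply, smul_eq_mul, Nat.add_sub_cancel]
        congr 2
        have := i.2
        omega
      rw [hsum]
      split_ifs with hk0
      · have := hS (l + 1) (by omega)
        rw [Finset.sum_range_succ] at this
        subst hk0
        simp only [Fin.val_zero, Nat.cast_zero, sub_zero]
        push_cast at this
        rw [eq_neg_of_add_eq_zero_left this]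
        simp [he0, pow_succ]
      · have hkpos : 0 < (k : ℕ) := Nat.pos_of_ne_zero fun h => hk0 (Fin.ext h)
        have hkl := k.2
        rw [← hS (l + 1 - k) (by omega)]
        symm
        have hcast : ((l + 1 - k : ℕ) : ℤ) = (l : ℤ) + 1 - k := by omega
        rw [hcast]
        refine Finset.sum_subset (by intro m; simp; omega) fun m _ hm => ?_
        rw [hneg _ (by simp at hm; omega), mul_zero]
    rw [hcol] at hdet
    have hc : c (Fin.last l) = 1 := by simp [c, h0]
    rw [hc, one_smul, Matrix.det_succ_column _ (Fin.last l), Finset.sum_eq_single 0] at hdet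
    · rw [← hdet]
      have hsub : ((M.updateCol (Fin.last l)
            fun k => if k = 0 then (-1) ^ l * h (l + 1) else 0).submatrix
          (Fin.succAbove 0) (Fin.last l).succAbove) =
          Matrix.of fun i j : Fin l => e ((j : ℤ) - i) := by
        ext i j
        simp only [Matrix.submatrix_apply, Fin.succAbove_last, Fin.succAbove_zero]
        rw [Matrix.updateCol_ne (Fin.castSucc_lt_last j).ne]
        simp only [M, Matrix.of_apply, Fin.val_castSucc, Fin.val_succ]
        congr 1
        push_cast
        ring
      rw [hsub, det_unitriangular e he0 hneg]
      have hd : (-1 : A) ^ l * (-1) ^ l = 1 := by rw [← mul_pow]; simp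
      simp only [Fin.val_zero, Fin.val_last, zero_add, Matrix.updateCol_self, if_true, mul_one]
      linear_combination (h (l + 1)) * hd
    · intro i _ hi
      simp [hi]
    · simp

/-- The dual Pieri rule for Kostka–Naegelsbach determinants. -/
theorem homog_mul_kostkaDet (e : ℤ → A) (h : ℕ → A) (he0 : e 0 = 1) (hneg : ∀ k < 0, e k = 0)
    (hh : ∀ n, ∑ p ∈ Finset.HasAntidiagonal.antidiagonal n, h p.1 * ((-1) ^ p.2 * e p.2) =
      if n = 0 then 1 else 0) (t l : ℕ) (a : ℕ → ℕ) (ha : ∀ i, t ≤ i → a i = 0) :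
    h l * kostkaDet e t a = ∑ B ∈ Finset.powersetCard l (Finset.univ : Finset (Fin (t + l))),
      kostkaDet e (t + l) fun i => a i + if ∃ j ∈ B, (j : ℕ) = i then 1 else 0 := by
  obtain ⟨g, hg⟩ : ∃ g : Fin (t + l) → ℕ → A, ∀ i j, g i j = e ((a i : ℤ) + j - i) :=
    ⟨_, fun _ _ => rfl⟩
  obtain ⟨M, hM⟩ : ∃ M : Matrix (Fin (t + l)) (Fin (t + l)) A,
      M = Matrix.of fun i j : Fin (t + l) => g i (j + if t ≤ (j : ℕ) then 1 else 0) := ⟨_, rfl⟩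
  have h2 : (Matrix.of fun i j : Fin l => M (Fin.natAdd t i) (Fin.natAdd t j)) =
      Matrix.of fun i j : Fin l => e (1 + (j : ℤ) - i) := by
    ext i j
    simp only [hM, hg, Matrix.of_apply]
    rw [ha _ (by simp)]
    congr 1
    simp
    ring
  have h3 : (Matrix.of fun i j : Fin t => M (Fin.castAdd l i) (Fin.castAdd l j)) =
      Matrix.of fun i j : Fin t => e ((a i : ℤ) + j - i) := by
    ext i j
    have := j.2
    simp [hM, hg, not_le.2 this]
  have h4 : ∀ (i : Fin l) (j : Fin t), M (Fin.natAdd t i) (Fin.castAdd l j) = 0 := by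
    intro i j
    have := j.2
    simp only [hM, hg, Matrix.of_apply]
    rw [ha _ (by simp)]
    exact hneg _ (by simp; omega)
  calc h l * kostkaDet e t a = M.det := by
        rw [det_eq_mul_of_lower_left_zero M h4, h2, h3, det_eq_homog e h he0 hneg hh, mul_comm,
          kostkaDet]
    _ = ∑ B ∈ Finset.powersetCard l (Finset.univ : Finset (Fin (t + l))),
          (Matrix.of fun i j : Fin (t + l) => g i (j + if i ∈ B then 1 else 0)).det := by
        rw [hM, sum_det_shift_rows, sum_det_shift_cols]
    _ = _ := by
        refine Finset.sum_congr rfl fun B _ => ?_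
        rw [kostkaDet]
        congr 1
        ext i j
        simp only [hg, Matrix.of_apply]
        congr 1
        have : (∃ j ∈ B, (j : ℕ) = i) ↔ i ∈ B :=
          ⟨fun ⟨j, hj, hji⟩ => Fin.ext hji ▸ hj, fun h => ⟨i, h, rfl⟩⟩
        simp only [this]
        push_cast
        ring

end Determinants

/-! ### Young diagrams, horizontal strips and the Pieri rule -/

section Diagrams

open Finset

theorem colLen_eq_zero {μ : YoungDiagram} {j : ℕ} (h : μ.rowLen 0 ≤ j) : μ.colLen j = 0 := by
  by_contra hne
  have h1 : (0, j) ∈ μ := YoungDiagram.mem_iff_lt_colLen.2 (Nat.pos_of_ne_zero hne)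
  rw [YoungDiagram.mem_iff_lt_rowLen] at h1
  omega

theorem diagram_ext_colLen {μ ν : YoungDiagram} (h : ∀ j, μ.colLen j = ν.colLen j) : μ = ν := by
  ext ⟨i, j⟩
  simp only [YoungDiagram.mem_cells, YoungDiagram.mem_iff_lt_colLen, h]

theorem card_eq_sum_colLen {μ : YoungDiagram} {n : ℕ} (h : μ.rowLen 0 ≤ n) :
    μ.card = ∑ j ∈ range n, μ.colLen j := by
  rw [YoungDiagram.card, Finset.card_eq_sum_card_fiberwise (f := Prod.snd) (t := range n)]
  · exact Finset.sum_congr rfl fun j _ => (μ.colLen_eq_card).symm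
  · intro c hc
    have hc' : (c.1, c.2) ∈ μ := hc
    have := YoungDiagram.mem_iff_lt_colLen.1 hc'
    simp only [coe_range, Set.mem_Iio]
    by_contra hn
    rw [colLen_eq_zero (by omega)] at this
    omega

/-- Every antitone, eventually zero sequence is the sequence of column lengths of a diagram. -/
theorem exists_diagram_colLen (a : ℕ → ℕ) (ha : Antitone a) (n : ℕ) (hn : ∀ j, n ≤ j → a j = 0) :
    ∃ μ : YoungDiagram, ∀ j, μ.colLen j = a j := by
  let μ : YoungDiagram :=
    { cells := (range (a 0) ×ˢ range n).filter fun c => c.1 < a c.2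
      isLowerSet := by
        rintro ⟨i, j⟩ ⟨i', j'⟩ ⟨h1, h2⟩ h
        simp only [coe_filter, mem_product, mem_range, Set.mem_ofPred_eq] at h h1 h2 ⊢
        have := ha h2
        omega }
  have hμ : ∀ i j, (i, j) ∈ μ ↔ i < a j := by
    intro i j
    change (i, j) ∈ (range (a 0) ×ˢ range n).filter _ ↔ _
    simp only [mem_filter, mem_product, mem_range]
    refine ⟨fun h => h.2, fun h => ⟨⟨h.trans_le (ha (Nat.zero_le j)), ?_⟩, h⟩⟩
    by_contra hj
    rw [hn j (by omega)] at h
    omega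
  refine ⟨μ, fun j => ?_⟩
  have h1 := hμ (μ.colLen j) j
  have h2 := hμ (a j) j
  rw [YoungDiagram.mem_iff_lt_colLen] at h1 h2
  omega

theorem finite_setOf_card_eq (d : ℕ) : {μ : YoungDiagram | μ.card = d}.Finite := by
  refine Set.Finite.of_injOn (f := YoungDiagram.cells)
    (t := ((range d ×ˢ range d).powerset : Finset (Finset (ℕ × ℕ)))) ?_ ?_ (Finset.finite_toSet _)
  · intro μ hμ
    simp only [coe_powerset, Set.mem_preimage, Set.mem_powerset_iff, coe_subset]
    rintro ⟨i, j⟩ hc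
    have hd : μ.cells.card = d := hμ
    have h1 : i < μ.colLen j := YoungDiagram.mem_iff_lt_colLen.1 hc
    have h2 : j < μ.rowLen i := YoungDiagram.mem_iff_lt_rowLen.1 hc
    rw [YoungDiagram.colLen_eq_card] at h1
    rw [YoungDiagram.rowLen_eq_card] at h2
    have h3 : (μ.col j).card ≤ μ.cells.card := card_le_card (filter_subset _ _)
    have h4 : (μ.row i).card ≤ μ.cells.card := card_le_card (filter_subset _ _)
    simp only [mem_product, mem_range]
    omega
  · intro μ _ ν _ h
    exact YoungDiagram.ext h

/-- The finite set of Young diagrams with `d` cells. -/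
noncomputable def diagramsOfCard (d : ℕ) : Finset YoungDiagram := (finite_setOf_card_eq d).toFinset

@[simp] theorem mem_diagramsOfCard {d : ℕ} {μ : YoungDiagram} :
    μ ∈ diagramsOfCard d ↔ μ.card = d := by
  simp [diagramsOfCard]

/-- `lam ⊆ μ` and the skew diagram `μ / lam` has at most one cell in each column. -/
def IsHorizontalStrip (lam μ : YoungDiagram) : Prop :=
  ∀ j, lam.colLen j ≤ μ.colLen j ∧ μ.colLen j ≤ lam.colLen j + 1

theorem IsHorizontalStrip.rowLen_le {lam μ : YoungDiagram} (h : IsHorizontalStrip lam μ) {l : ℕ}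
    (hc : μ.card = lam.card + l) : μ.rowLen 0 ≤ lam.rowLen 0 + l := by
  rw [card_eq_sum_colLen (n := lam.rowLen 0 + μ.rowLen 0) (by omega),
    card_eq_sum_colLen (n := lam.rowLen 0 + μ.rowLen 0) (by omega)] at hc
  by_contra hlt
  -- each column of `μ` beyond the first row of `lam` contributes a cell of the skew diagram
  have h1 : ∑ j ∈ range (lam.rowLen 0 + μ.rowLen 0), lam.colLen j +
      ((range (lam.rowLen 0 + μ.rowLen 0)).filter
        fun j => lam.rowLen 0 ≤ j ∧ j < μ.rowLen 0).card ≤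
      ∑ j ∈ range (lam.rowLen 0 + μ.rowLen 0), μ.colLen j := by
    rw [Finset.card_filter, ← Finset.sum_add_distrib]
    refine Finset.sum_le_sum fun j _ => ?_
    split_ifs with hj
    · rw [colLen_eq_zero hj.1]
      have : (0, j) ∈ μ := YoungDiagram.mem_iff_lt_rowLen.2 hj.2
      have := YoungDiagram.mem_iff_lt_colLen.1 this
      omega
    · simpa using (h j).1
  have h2 : ((range (lam.rowLen 0 + μ.rowLen 0)).filter
        fun j => lam.rowLen 0 ≤ j ∧ j < μ.rowLen 0) = Finset.Ico (lam.rowLen 0) (μ.rowLen 0) := by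
    ext j
    simp only [mem_filter, mem_range, mem_Ico]
    omega
  rw [h2, Nat.card_Ico] at h1
  omega

end Diagrams

section Pieri

open Finset

variable {A : Type*} [CommRing A]

/-- The Kostka–Naegelsbach determinant of a Young diagram. -/
def schurDet (e : ℤ → A) (μ : YoungDiagram) : A := kostkaDet e (μ.rowLen 0) μ.colLen

theorem kostkaDet_colLen (e : ℤ → A) (he0 : e 0 = 1) (hneg : ∀ k < 0, e k = 0)
    {μ : YoungDiagram} {n : ℕ} (h : μ.rowLen 0 ≤ n) :
    kostkaDet e n μ.colLen = schurDet e μ := by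
  obtain ⟨l, rfl⟩ := Nat.exists_eq_add_of_le h
  exact kostkaDet_add e he0 hneg _ l _ fun i hi => colLen_eq_zero hi

/-- If column `i + 1` is longer than column `i` by one cell, then rows `i` and `i + 1` of the
determinant coincide. This removes the terms of the Pieri rule that are not Young diagrams. -/
theorem kostkaDet_eq_zero_of_succ_eq (e : ℤ → A) {n : ℕ} (a : ℕ → ℕ) (i : ℕ) (hi : i + 1 < n)
    (h : a (i + 1) = a i + 1) : kostkaDet e n a = 0 := by
  apply Matrix.det_zero_of_row_eq (i := ⟨i, by omega⟩) (j := ⟨i + 1, hi⟩)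
  · simp
  · funext j
    simp only [Matrix.of_apply]
    congr 1
    rw [h]
    push_cast
    ring

open Classical in
/-- The Pieri rule: multiplication by `h_l` adds horizontal strips of size `l`. -/
theorem homog_mul_schurDet (e : ℤ → A) (h : ℕ → A) (he0 : e 0 = 1) (hneg : ∀ k < 0, e k = 0)
    (hh : ∀ n, ∑ p ∈ Finset.HasAntidiagonal.antidiagonal n, h p.1 * ((-1) ^ p.2 * e p.2) =
      if n = 0 then 1 else 0) (lam : YoungDiagram) (l : ℕ) :
    h l * schurDet e lam =
      ∑ μ ∈ diagramsOfCard (lam.card + l) with IsHorizontalStrip lam μ, schurDet e μ := by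
  set t := lam.rowLen 0 with ht
  rw [schurDet, homog_mul_kostkaDet e h he0 hneg hh _ l _ fun i hi => colLen_eq_zero hi]
  symm
  let B : YoungDiagram → Finset (Fin (t + l)) := fun μ =>
    Finset.univ.filter fun j => μ.colLen j = lam.colLen j + 1
  have hB : ∀ μ, μ.card = lam.card + l → IsHorizontalStrip lam μ → ∀ i,
      μ.colLen i = lam.colLen i + if ∃ j ∈ B μ, (j : ℕ) = i then 1 else 0 := by
    intro μ hc hs i
    split_ifs with hj
    · obtain ⟨j, hj, rfl⟩ := hj
      exact (mem_filter.1 hj).2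
    · have hle := hs.rowLen_le hc
      have := hs i
      rcases lt_or_ge i (t + l) with hi | hi
      · have : ¬ μ.colLen i = lam.colLen i + 1 := fun h' =>
          hj ⟨⟨i, hi⟩, mem_filter.2 ⟨mem_univ _, h'⟩, rfl⟩
        omega
      · rw [colLen_eq_zero (hle.trans hi), colLen_eq_zero (by omega : lam.rowLen 0 ≤ i)]
  have hsum : ∀ B : Finset (Fin (t + l)),
      ∑ i ∈ range (t + l), (lam.colLen i + if ∃ j ∈ B, (j : ℕ) = i then 1 else 0) =
        lam.card + B.card := by
    intro B
    rw [Finset.sum_add_distrib, ← card_eq_sum_colLen (by omega), ← Finset.card_filter]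
    congr 1
    rw [← Finset.card_map Fin.valEmbedding (s := B)]
    congr 1
    ext i
    simp only [mem_filter, mem_range, mem_map, Fin.valEmbedding_apply]
    exact ⟨fun h => h.2, fun ⟨j, hj, hji⟩ => ⟨hji ▸ j.2, j, hj, hji⟩⟩
  refine Finset.sum_of_injOn B ?_ ?_ ?_ ?_
  · intro μ hμ ν hν hBe
    simp only [coe_filter, mem_diagramsOfCard, Set.mem_ofPred_eq] at hμ hν
    refine diagram_ext_colLen fun j => ?_
    rw [hB μ hμ.1 hμ.2, hB ν hν.1 hν.2, hBe]
  · intro μ hμ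
    simp only [coe_filter, mem_diagramsOfCard, Set.mem_ofPred_eq] at hμ
    simp only [mem_coe, mem_powersetCard, subset_univ, true_and]
    have h1 := hsum (B μ)
    have h2 := card_eq_sum_colLen (hμ.2.rowLen_le hμ.1)
    rw [Finset.sum_congr rfl fun i _ => hB μ hμ.1 hμ.2 i, h1] at h2
    omega
  · intro C hC hCB
    have hcard := (mem_powersetCard.1 hC).2
    set b : ℕ → ℕ := fun i => lam.colLen i + if ∃ j ∈ C, (j : ℕ) = i then 1 else 0 with hb
    have hb0 : ∀ i, t + l ≤ i → b i = 0 := by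
      intro i hi
      have : ¬ ∃ j ∈ C, (j : ℕ) = i := by rintro ⟨j, _, rfl⟩; have := j.2; omega
      simp only [hb, if_neg this, colLen_eq_zero (by omega : lam.rowLen 0 ≤ i)]
    by_cases hanti : ∀ i, b (i + 1) ≤ b i
    · exfalso
      obtain ⟨μ, hμ⟩ := exists_diagram_colLen b (antitone_nat_of_succ_le hanti) (t + l) hb0
      have hrow : μ.rowLen 0 ≤ t + l := by
        by_contra hlt
        have h1 : (0, t + l) ∈ μ := YoungDiagram.mem_iff_lt_rowLen.2 (by omega)
        rw [YoungDiagram.mem_iff_lt_colLen, hμ, hb0 _ le_rfl] at h1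
        omega
      have hc : μ.card = lam.card + l := by
        rw [card_eq_sum_colLen hrow, Finset.sum_congr rfl fun i _ => hμ i, hsum, hcard]
      have hs : IsHorizontalStrip lam μ := by
        intro j
        rw [hμ, hb]
        dsimp only
        split_ifs <;> omega
      refine hCB ⟨μ, by simp [hc, hs], ?_⟩
      ext j
      simp only [B, mem_filter, mem_univ, true_and, hμ, hb]
      have : (∃ k ∈ C, (k : ℕ) = j) ↔ j ∈ C :=
        ⟨fun ⟨k, hk, hkj⟩ => Fin.ext hkj ▸ hk, fun h => ⟨j, h, rfl⟩⟩
      simp [this]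
    · push Not at hanti
      obtain ⟨i, hi⟩ := hanti
      have hlam := lam.colLen_anti i (i + 1) (by omega)
      have hi' : b (i + 1) = b i + 1 ∧ i + 1 < t + l := by
        constructor
        · have e1 : b i = lam.colLen i + if ∃ j ∈ C, (j : ℕ) = i then 1 else 0 := rfl
          have e2 : b (i + 1) = lam.colLen (i + 1) +
            if ∃ j ∈ C, (j : ℕ) = i + 1 then 1 else 0 := rfl
          split_ifs at e1 e2 <;> omega
        · by_contra hge
          have := hb0 (i + 1) (by omega)
          omega
      exact kostkaDet_eq_zero_of_succ_eq e b i hi'.2 hi'.1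
  · intro μ hμ
    simp only [mem_filter, mem_diagramsOfCard] at hμ
    rw [← kostkaDet_colLen e he0 hneg (hμ.2.rowLen_le hμ.1)]
    congr 1
    funext i
    exact hB μ hμ.1 hμ.2 i

end Pieri

/-! ### Semistandard tableaux and the Cauchy identity -/

section Tableaux

open Finset

/-- The semistandard tableaux of shape `μ` in which each `i` occurs exactly `α i` times. -/
def TableauxOfContent (μ : YoungDiagram) (α : ℕ →₀ ℕ) : Type :=
  {T : SemistandardYoungTableau μ // ∀ i : ℕ, (μ.cells.filter fun c => T c.1 c.2 = i).card = α i}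

theorem TableauxOfContent.mem_support {μ : YoungDiagram} {α : ℕ →₀ ℕ} (T : TableauxOfContent μ α)
    {c : ℕ × ℕ} (hc : c ∈ μ) : T.1 c.1 c.2 ∈ α.support := by
  rw [Finsupp.mem_support_iff, ← T.2, ← Nat.pos_iff_ne_zero, Finset.card_pos]
  exact ⟨c, mem_filter.2 ⟨hc, rfl⟩⟩

instance (μ : YoungDiagram) (α : ℕ →₀ ℕ) : Finite (TableauxOfContent μ α) := by
  refine Finite.of_injective (β := μ.cells → α.support)
    (fun T c => ⟨T.1 c.1.1 c.1.2, T.mem_support c.2⟩) ?_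
  intro T T' h
  apply Subtype.ext
  ext i j
  by_cases hc : (i, j) ∈ μ
  · have := congrFun h ⟨(i, j), hc⟩
    exact congrArg Subtype.val this
  · rw [T.1.zeros hc, T'.1.zeros hc]

theorem TableauxOfContent.card_eq {μ : YoungDiagram} {α : ℕ →₀ ℕ} (T : TableauxOfContent μ α)
    {s : Finset ℕ} (hs : α.support ⊆ s) : μ.card = ∑ i ∈ s, α i := by
  rw [YoungDiagram.card, Finset.card_eq_sum_card_fiberwise (f := fun c => T.1 c.1 c.2) (t := s)]
  · exact Finset.sum_congr rfl fun i _ => T.2 i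
  · exact fun c hc => hs (T.mem_support hc)

/-- The Kostka number: the number of semistandard tableaux of given shape and content. -/
noncomputable def kostka (μ : YoungDiagram) (α : ℕ →₀ ℕ) : ℕ := Nat.card (TableauxOfContent μ α)

theorem kostka_eq_zero {μ : YoungDiagram} {α : ℕ →₀ ℕ} {s : Finset ℕ} (hs : α.support ⊆ s)
    (h : μ.card ≠ ∑ i ∈ s, α i) : kostka μ α = 0 := by
  rw [kostka, Nat.card_eq_zero]
  exact Or.inl ⟨fun T => h (T.card_eq hs)⟩

theorem kostka_bot_zero : kostka ⊥ 0 = 1 := by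
  rw [kostka, Nat.card_eq_one_iff_unique]
  refine ⟨⟨fun T T' => Subtype.ext ?_⟩, ⟨⟨default, by simp⟩⟩⟩
  ext i j
  rw [T.1.zeros (YoungDiagram.notMem_bot _), T'.1.zeros (YoungDiagram.notMem_bot _)]

/-- The subdiagram of the cells of a tableau with entries smaller than `n`. -/
def cellsBelow {μ : YoungDiagram} (T : SemistandardYoungTableau μ) (n : ℕ) : YoungDiagram where
  cells := μ.cells.filter fun c => T c.1 c.2 < n
  isLowerSet := by
    rintro ⟨i, j⟩ ⟨i', j'⟩ ⟨h1, h2⟩ h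
    simp only [coe_filter, YoungDiagram.mem_cells, Set.mem_ofPred_eq] at h h1 h2 ⊢
    have hm : (i', j) ∈ μ := μ.up_left_mem h1 le_rfl h.1
    have e1 := T.row_weak_of_le h2 hm
    have e2 := T.col_weak h1 h.1
    exact ⟨μ.up_left_mem le_rfl h2 hm, by omega⟩

theorem mem_cellsBelow {μ : YoungDiagram} {T : SemistandardYoungTableau μ} {n : ℕ} {c : ℕ × ℕ} :
    c ∈ cellsBelow T n ↔ c ∈ μ ∧ T c.1 c.2 < n := by
  change c ∈ μ.cells.filter _ ↔ _
  simp

theorem cellsBelow_isHorizontalStrip {μ : YoungDiagram} (T : SemistandardYoungTableau μ) (n : ℕ)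
    (hT : ∀ c ∈ μ, T c.1 c.2 ≤ n) : IsHorizontalStrip (cellsBelow T n) μ := by
  intro j
  set r := (cellsBelow T n).colLen j with hr
  have hr' : (r, j) ∉ cellsBelow T n := by
    rw [YoungDiagram.mem_iff_lt_colLen]; omega
  constructor
  · by_contra hlt
    have h1 : (μ.colLen j, j) ∈ cellsBelow T n := YoungDiagram.mem_iff_lt_colLen.2 (by omega)
    have := YoungDiagram.mem_iff_lt_colLen.1 (mem_cellsBelow.1 h1).1
    omega
  · by_contra hlt
    have h1 : (r + 1, j) ∈ μ := YoungDiagram.mem_iff_lt_colLen.2 (by omega)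
    have h2 : (r, j) ∈ μ := μ.up_left_mem (Nat.le_succ r) le_rfl h1
    have h3 := T.col_strict (Nat.lt_add_one r) h1
    have h4 := hT _ h1
    exact hr' (mem_cellsBelow.2 ⟨h2, by dsimp only at h4 ⊢; omega⟩)

/-- The restriction of a tableau to a smaller diagram. -/
def restrictTableau {lam μ : YoungDiagram} (h : lam ≤ μ) (T : SemistandardYoungTableau μ) :
    SemistandardYoungTableau lam where
  entry i j := if (i, j) ∈ lam then T i j else 0
  row_weak' := by
    intro i j1 j2 hj h2
    rw [if_pos h2, if_pos (lam.up_left_mem le_rfl hj.le h2)]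
    exact T.row_weak hj (h h2)
  col_strict' := by
    intro i1 i2 j hi h2
    rw [if_pos h2, if_pos (lam.up_left_mem hi.le le_rfl h2)]
    exact T.col_strict hi (h h2)
  zeros' h := if_neg h

theorem restrictTableau_apply {lam μ : YoungDiagram} (h : lam ≤ μ) (T : SemistandardYoungTableau μ)
    (i j : ℕ) : restrictTableau h T i j = if (i, j) ∈ lam then T i j else 0 := rfl

theorem IsHorizontalStrip.le {lam μ : YoungDiagram} (h : IsHorizontalStrip lam μ) : lam ≤ μ := by
  rintro ⟨i, j⟩ hc
  change (i, j) ∈ lam at hc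
  rw [YoungDiagram.mem_iff_lt_colLen] at hc ⊢
  exact hc.trans_le (h j).1

/-- The tableau of shape `μ` obtained from a tableau of shape `lam` with entries smaller than `n` by
filling the cells of the horizontal strip `μ / lam` with `n`. -/
def fillStrip {lam μ : YoungDiagram} (hs : IsHorizontalStrip lam μ) (n : ℕ)
    (T : SemistandardYoungTableau lam) (hT : ∀ c ∈ lam, T c.1 c.2 < n) :
    SemistandardYoungTableau μ where
  entry i j := if (i, j) ∈ lam then T i j else if (i, j) ∈ μ then n else 0
  row_weak' := by
    intro i j1 j2 hj h
    by_cases h2 : (i, j2) ∈ lam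
    · have h1 : (i, j1) ∈ lam := lam.up_left_mem le_rfl hj.le h2
      rw [if_pos h1, if_pos h2]
      exact T.row_weak hj h2
    · rw [if_neg h2, if_pos h]
      split_ifs with h1 h3
      · exact (hT _ h1).le
      · exact le_rfl
      · exact Nat.zero_le _
  col_strict' := by
    intro i1 i2 j hi h
    by_cases h2 : (i2, j) ∈ lam
    · have h1 : (i1, j) ∈ lam := lam.up_left_mem hi.le le_rfl h2
      rw [if_pos h1, if_pos h2]
      exact T.col_strict hi h2
    · have h1 : (i1, j) ∈ lam := by
        rw [YoungDiagram.mem_iff_lt_colLen] at h ⊢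
        have := (hs j).2
        omega
      rw [if_pos h1, if_neg h2, if_pos h]
      exact hT _ h1
  zeros' := by
    intro i j h
    rw [if_neg fun h' => h (hs.le h'), if_neg h]

theorem fillStrip_apply {lam μ : YoungDiagram} (hs : IsHorizontalStrip lam μ) (n : ℕ)
    (T : SemistandardYoungTableau lam) (hT : ∀ c ∈ lam, T c.1 c.2 < n) (i j : ℕ) :
    fillStrip hs n T hT i j = if (i, j) ∈ lam then T i j else if (i, j) ∈ μ then n else 0 := rfl

theorem restrictTableau_content {lam μ : YoungDiagram} (hle : lam ≤ μ) {α : ℕ →₀ ℕ} {n : ℕ}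
    (hα : α.support ⊆ range (n + 1)) (T : TableauxOfContent μ α) (hT : cellsBelow T.1 n = lam)
    (i : ℕ) : (lam.cells.filter fun c => restrictTableau hle T.1 c.1 c.2 = i).card =
      α.erase n i := by
  have hf : (lam.cells.filter fun c => restrictTableau hle T.1 c.1 c.2 = i) =
      μ.cells.filter fun c => T.1 c.1 c.2 = i ∧ i < n := by
    ext ⟨a, b⟩
    simp only [mem_filter, YoungDiagram.mem_cells]
    simp only [restrictTableau_apply]
    have hm : (a, b) ∈ lam ↔ (a, b) ∈ μ ∧ T.1 a b < n := by rw [← hT, mem_cellsBelow]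
    constructor
    · rintro ⟨h1, h2⟩
      rw [if_pos h1] at h2
      have := hm.1 h1
      exact ⟨this.1, h2, h2 ▸ this.2⟩
    · rintro ⟨h1, h2, h3⟩
      have := hm.2 ⟨h1, by omega⟩
      exact ⟨this, by rw [if_pos this, h2]⟩
  rw [hf]
  rcases lt_or_ge i n with hi | hi
  · simp only [hi, and_true]
    rw [T.2, Finsupp.erase_ne hi.ne]
  · have h0 : α.erase n i = 0 := by
      rcases eq_or_lt_of_le hi with rfl | hi
      · exact Finsupp.erase_same
      · rw [Finsupp.erase_ne hi.ne']
        by_contra hne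
        have := mem_range.1 (hα (Finsupp.mem_support_iff.2 hne))
        omega
    rw [h0, Finset.card_eq_zero, Finset.filter_eq_empty_iff]
    intro c _ h
    omega

theorem erase_support_subset {α : ℕ →₀ ℕ} {n : ℕ} (hα : α.support ⊆ range (n + 1)) :
    (α.erase n).support ⊆ range n := by
  intro i hi
  rw [Finsupp.support_erase, mem_erase] at hi
  have := mem_range.1 (hα hi.2)
  exact mem_range.2 (by omega)

theorem fillStrip_content {lam μ : YoungDiagram} (hs : IsHorizontalStrip lam μ) {α : ℕ →₀ ℕ}
    {n : ℕ} (hc : μ.card = lam.card + α n) (T : TableauxOfContent lam (α.erase n))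
    (hT : ∀ c ∈ lam, T.1 c.1 c.2 < n) (i : ℕ) :
    (μ.cells.filter fun c => fillStrip hs n T.1 hT c.1 c.2 = i).card = α i := by
  have hsub : lam.cells ⊆ μ.cells := YoungDiagram.cells_subset_iff.2 hs.le
  by_cases hi : i = n
  · subst hi
    have : (μ.cells.filter fun c => fillStrip hs i T.1 hT c.1 c.2 = i) = μ.cells \ lam.cells := by
      ext ⟨a, b⟩
      simp only [mem_filter, mem_sdiff, YoungDiagram.mem_cells]
      simp only [fillStrip_apply]
      constructor
      · rintro ⟨h1, h2⟩
        refine ⟨h1, fun h3 => ?_⟩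
        rw [if_pos h3] at h2
        exact (hT _ h3).ne h2
      · rintro ⟨h1, h2⟩
        exact ⟨h1, by rw [if_neg h2, if_pos h1]⟩
    rw [this, Finset.card_sdiff_of_subset hsub]
    simp only [YoungDiagram.card] at hc
    omega
  · rw [← Finsupp.erase_ne hi, ← T.2 i]
    congr 1
    ext ⟨a, b⟩
    simp only [mem_filter, YoungDiagram.mem_cells]
    simp only [fillStrip_apply]
    constructor
    · rintro ⟨h1, h2⟩
      by_cases h3 : (a, b) ∈ lam
      · rw [if_pos h3] at h2
        exact ⟨h3, h2⟩
      · rw [if_neg h3, if_pos h1] at h2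
        exact absurd h2.symm hi
    · rintro ⟨h1, h2⟩
      exact ⟨hsub h1, by rw [if_pos h1, h2]⟩

theorem card_fiber_cellsBelow {lam μ : YoungDiagram} (hs : IsHorizontalStrip lam μ) {α : ℕ →₀ ℕ}
    {n : ℕ} (hα : α.support ⊆ range (n + 1)) (hc : μ.card = lam.card + α n) :
    Nat.card {T : TableauxOfContent μ α // cellsBelow T.1 n = lam} = kostka lam (α.erase n) := by
  have hT : ∀ T : TableauxOfContent lam (α.erase n), ∀ c ∈ lam, T.1 c.1 c.2 < n := fun T c hc =>
    mem_range.1 (erase_support_subset hα (T.mem_support hc))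
  refine Nat.card_congr
    { toFun := fun T => ⟨restrictTableau hs.le T.1.1, restrictTableau_content hs.le hα T.1 T.2⟩
      invFun := fun T => ⟨⟨fillStrip hs n T.1 (hT T), fillStrip_content hs hc T (hT T)⟩, ?_⟩
      left_inv := ?_
      right_inv := ?_ }
  · ext ⟨i, j⟩
    simp only [YoungDiagram.mem_cells, mem_cellsBelow, fillStrip_apply]
    constructor
    · rintro ⟨h1, h2⟩
      by_contra h3
      rw [if_neg h3, if_pos h1] at h2
      exact lt_irrefl _ h2
    · intro h
      exact ⟨hs.le h, by rw [if_pos h]; exact hT T _ h⟩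
  · rintro ⟨T, hTl⟩
    refine Subtype.ext (Subtype.ext ?_)
    ext i j
    simp only [fillStrip_apply, restrictTableau_apply]
    split_ifs with h1 h2
    · rfl
    · have h3 : ¬ T.1 i j < n := fun h => h1 (hTl ▸ mem_cellsBelow.2 ⟨h2, h⟩)
      have h4 := mem_range.1 (hα (T.mem_support h2))
      dsimp only at h4
      omega
    · exact (T.1.zeros h2).symm
  · intro T
    refine Subtype.ext ?_
    ext i j
    simp only [fillStrip_apply, restrictTableau_apply]
    split_ifs with h1
    · rfl
    · exact (T.1.zeros h1).symm

open Classical in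
/-- Removing the largest entry from semistandard tableaux. -/
theorem kostka_eq_sum {μ : YoungDiagram} {α : ℕ →₀ ℕ} {n d : ℕ} (hα : α.support ⊆ range (n + 1))
    (hc : μ.card = d + α n) :
    kostka μ α = ∑ lam ∈ diagramsOfCard d with IsHorizontalStrip lam μ, kostka lam (α.erase n) := by
  have hmem : ∀ T : TableauxOfContent μ α,
      cellsBelow T.1 n ∈ (diagramsOfCard d).filter (IsHorizontalStrip · μ) := by
    intro T
    simp only [mem_filter, mem_diagramsOfCard]
    have hle : ∀ c ∈ μ, T.1 c.1 c.2 ≤ n := fun c hc =>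
      Nat.lt_succ_iff.1 (mem_range.1 (hα (T.mem_support hc)))
    refine ⟨?_, cellsBelow_isHorizontalStrip _ _ hle⟩
    have h1 := Finset.card_filter_add_card_filter_not (s := μ.cells) (fun c => T.1 c.1 c.2 < n)
    have h2 : (μ.cells.filter fun c => ¬ T.1 c.1 c.2 < n) =
        μ.cells.filter fun c => T.1 c.1 c.2 = n := by
      refine Finset.filter_congr fun c hc => ?_
      have := hle c hc
      omega
    rw [h2, T.2] at h1
    have h3 : (cellsBelow T.1 n).card + α n = μ.card := h1
    omega
  rw [kostka, ← Nat.card_congr (Equiv.sigmaFiberEquiv fun T : TableauxOfContent μ α =>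
    (⟨cellsBelow T.1 n, hmem T⟩ : {x // x ∈ (diagramsOfCard d).filter (IsHorizontalStrip · μ)})),
    Nat.card_sigma,
    ← Finset.sum_coe_sort ((diagramsOfCard d).filter (IsHorizontalStrip · μ))
      (fun lam => kostka lam (α.erase n))]
  refine Finset.sum_congr rfl fun lam _ => ?_
  have hl := lam.2
  simp only [mem_filter, mem_diagramsOfCard] at hl
  rw [← card_fiber_cellsBelow hl.2 hα (by omega)]
  exact Nat.card_congr (Equiv.subtypeEquivRight fun T => Subtype.ext_iff)

end Tableaux

section Cauchy

open Finset

variable {A : Type*} [CommRing A]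

/-- The expansion of products of complete homogeneous symmetric functions in Schur functions, which
is the Cauchy identity read off coefficientwise. -/
theorem prod_homog_eq_sum_kostka (e : ℤ → A) (h : ℕ → A) (he0 : e 0 = 1) (hneg : ∀ k < 0, e k = 0)
    (hh : ∀ n, ∑ p ∈ Finset.HasAntidiagonal.antidiagonal n, h p.1 * ((-1) ^ p.2 * e p.2) =
      if n = 0 then 1 else 0) (n : ℕ) (α : ℕ →₀ ℕ) (hα : α.support ⊆ range n) :
    ((List.range n).map fun j => h (α j)).prod =
      ∑ μ ∈ diagramsOfCard (∑ j ∈ range n, α j), (kostka μ α : A) * schurDet e μ := by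
  classical
  induction n generalizing α with
  | zero =>
    have h0 : α = 0 := by simpa using hα
    subst h0
    have h1 : diagramsOfCard 0 = {⊥} := by
      ext μ
      simp only [mem_diagramsOfCard, mem_singleton, YoungDiagram.card, Finset.card_eq_zero]
      exact ⟨fun h => YoungDiagram.ext h, fun h => h ▸ rfl⟩
    have h2 : schurDet e ⊥ = 1 := by
      rw [← kostkaDet_colLen e he0 hneg (n := (⊥ : YoungDiagram).rowLen 0) le_rfl]
      have : (⊥ : YoungDiagram).rowLen 0 = 0 := by
        by_contra hne
        exact YoungDiagram.notMem_bot (0, 0)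
          (YoungDiagram.mem_iff_lt_rowLen.2 (Nat.pos_of_ne_zero hne))
      rw [this]
      simp [kostkaDet]
    simp [h1, h2, kostka_bot_zero]
  | succ n ih =>
    have hprod : ((List.range n).map fun j => h (α j)) =
        (List.range n).map fun j => h (α.erase n j) := by
      refine List.map_congr_left fun j hj => ?_
      rw [Finsupp.erase_ne (by have := List.mem_range.1 hj; omega)]
    have hdeg : ∑ j ∈ range n, α.erase n j = ∑ j ∈ range n, α j :=
      Finset.sum_congr rfl fun j hj => by
        rw [Finsupp.erase_ne (by have := mem_range.1 hj; omega)]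
    rw [List.range_succ, List.map_append, List.prod_append, hprod,
      ih _ (erase_support_subset hα), hdeg, Finset.sum_range_succ]
    simp only [List.map_cons, List.map_nil, List.prod_cons, List.prod_nil, mul_one]
    set d := ∑ j ∈ range n, α j
    calc _ = ∑ lam ∈ diagramsOfCard d, ∑ μ ∈ diagramsOfCard (d + α n),
          if IsHorizontalStrip lam μ then (kostka lam (α.erase n) : A) * schurDet e μ else 0 := by
          rw [Finset.sum_mul]
          refine Finset.sum_congr rfl fun lam hl => ?_
          rw [mem_diagramsOfCard] at hl
          rw [mul_assoc, mul_comm (schurDet e lam), homog_mul_schurDet e h he0 hneg hh, hl,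
            Finset.mul_sum, Finset.sum_filter]
      _ = ∑ μ ∈ diagramsOfCard (d + α n), ∑ lam ∈ diagramsOfCard d,
          if IsHorizontalStrip lam μ then (kostka lam (α.erase n) : A) * schurDet e μ else 0 :=
          Finset.sum_comm
      _ = _ := by
          refine Finset.sum_congr rfl fun μ hμ => ?_
          rw [mem_diagramsOfCard] at hμ
          rw [kostka_eq_sum hα hμ, Nat.cast_sum, Finset.sum_mul, Finset.sum_filter]

end Cauchy

/-! ### Linear independence of Schur functions -/

section Uniqueness

open Finset

theorem row_le_entry {μ : YoungDiagram} (T : SemistandardYoungTableau μ) {i j : ℕ}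
    (h : (i, j) ∈ μ) : i ≤ T i j := by
  induction i with
  | zero => exact Nat.zero_le _
  | succ i ih =>
    have := ih (μ.up_left_mem (Nat.le_succ i) le_rfl h)
    have := T.col_strict (Nat.lt_add_one i) h
    omega

/-- The content of the highest weight tableau of shape `μ`: the number `i` occurs as often as the
length of the `i`-th row. -/
noncomputable def rowContent (μ : YoungDiagram) : ℕ →₀ ℕ :=
  Finsupp.onFinset (range (μ.colLen 0)) μ.rowLen fun i hi => by
    have h1 : (i, 0) ∈ μ := YoungDiagram.mem_iff_lt_rowLen.2 (Nat.pos_of_ne_zero hi)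
    exact mem_range.2 (YoungDiagram.mem_iff_lt_colLen.1 h1)

@[simp] theorem rowContent_apply (μ : YoungDiagram) (i : ℕ) : rowContent μ i = μ.rowLen i := rfl

theorem filter_entry_subset_row {ν μ : YoungDiagram} (T : TableauxOfContent ν (rowContent μ))
    (i : ℕ) (h : ∀ j < i, ∀ k, (j, k) ∈ ν → T.1 j k = j) :
    (ν.cells.filter fun c => T.1 c.1 c.2 = i) ⊆ ν.row i := by
  rintro ⟨a, b⟩ hc
  rw [mem_filter, YoungDiagram.mem_cells] at hc
  rw [YoungDiagram.mem_row_iff]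
  refine ⟨hc.1, ?_⟩
  have h1 := row_le_entry T.1 hc.1
  by_contra hne
  have h2 : a < i := by
    have := hc.2
    dsimp only at this hne
    omega
  exact hne ((h a h2 b hc.1).symm.trans hc.2)

/-- As long as the row lengths of `ν` and `μ` agree, a tableau of shape `ν` whose content is given
by the row lengths of `μ` has all entries in row `j` equal to `j`. -/
theorem entry_eq_row {ν μ : YoungDiagram} (T : TableauxOfContent ν (rowContent μ)) (i : ℕ)
    (h : ∀ j < i, ν.rowLen j = μ.rowLen j) : ∀ j < i, ∀ k, (j, k) ∈ ν → T.1 j k = j := by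
  intro j
  induction j using Nat.strong_induction_on with
  | _ j ih =>
    intro hj k hk
    have hsub := filter_entry_subset_row T j fun j' hj' => ih j' hj' (hj'.trans hj)
    have heq := Finset.eq_of_subset_of_card_le hsub
      (by rw [T.2, rowContent_apply, ← YoungDiagram.rowLen_eq_card, h j hj])
    have : (j, k) ∈ ν.cells.filter fun c => T.1 c.1 c.2 = j := by
      rw [heq]
      exact YoungDiagram.mk_mem_row_iff.2 hk
    exact (mem_filter.1 this).2

theorem kostka_rowContent_self (μ : YoungDiagram) : kostka μ (rowContent μ) = 1 := by
  rw [kostka, Nat.card_eq_one_iff_unique]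
  constructor
  · refine ⟨fun T T' => Subtype.ext ?_⟩
    ext i j
    by_cases hc : (i, j) ∈ μ
    · rw [entry_eq_row T (i + 1) (fun _ _ => rfl) i (by omega) j hc,
        entry_eq_row T' (i + 1) (fun _ _ => rfl) i (by omega) j hc]
    · rw [T.1.zeros hc, T'.1.zeros hc]
  · refine ⟨⟨SemistandardYoungTableau.highestWeight μ, fun i => ?_⟩⟩
    rw [rowContent_apply, YoungDiagram.rowLen_eq_card]
    congr 1
    ext ⟨a, b⟩
    rw [mem_filter, YoungDiagram.mem_cells, YoungDiagram.mem_row_iff]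
    refine and_congr_right fun hc => ?_
    rw [SemistandardYoungTableau.highestWeight_apply, if_pos hc]

theorem kostka_rowContent_eq_zero {ν μ : YoungDiagram}
    (h : toLex (ν.rowLen : ℕ → ℕ) < toLex (μ.rowLen : ℕ → ℕ)) : kostka ν (rowContent μ) = 0 := by
  obtain ⟨i, hi, hlt⟩ := h
  rw [kostka, Nat.card_eq_zero]
  refine Or.inl ⟨fun T => ?_⟩
  have hsub := filter_entry_subset_row T i (entry_eq_row T i hi)
  have hle := Finset.card_le_card hsub
  rw [T.2, rowContent_apply, ← YoungDiagram.rowLen_eq_card] at hle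
  exact absurd hlt (not_lt.2 hle)

theorem sum_schur_apply (c : YoungDiagram →₀ ℤ) (α : ℕ →₀ ℕ) :
    (c.sum fun μ a => a • schur μ) α = ∑ μ ∈ c.support, c μ * kostka μ α := by
  rw [Finsupp.sum]
  change MvPowerSeries.coeff α (∑ μ ∈ c.support, c μ • schur μ) = _
  rw [map_sum]
  refine Finset.sum_congr rfl fun μ _ => ?_
  rw [map_smul, smul_eq_mul]
  rfl

/-- The Schur functions are linearly independent. -/
theorem eq_zero_of_sum_schur_eq_zero (c : YoungDiagram →₀ ℤ)
    (h : (c.sum fun μ a => a • schur μ) = 0) : c = 0 := by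
  by_contra hne
  -- pick the lexicographically largest shape and read off the coefficient at its row lengths
  obtain ⟨μ, hμ, hmax⟩ := Finset.exists_max_image c.support
    (fun μ => toLex (μ.rowLen : ℕ → ℕ)) (Finsupp.support_nonempty_iff.2 hne)
  have h1 := sum_schur_apply c (rowContent μ)
  rw [h, Finset.sum_eq_single μ] at h1
  · rw [kostka_rowContent_self, Nat.cast_one, mul_one] at h1
    exact Finsupp.mem_support_iff.1 hμ h1.symm
  · intro ν hν hνμ
    rw [kostka_rowContent_eq_zero, Nat.cast_zero, mul_zero]
    refine lt_of_le_of_ne (hmax ν hν) fun he => hνμ ?_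
    ext ⟨i, j⟩
    have : ν.rowLen i = μ.rowLen i := congrFun (toLex.injective he) i
    rw [YoungDiagram.mem_cells, YoungDiagram.mem_cells, YoungDiagram.mem_iff_lt_rowLen,
      YoungDiagram.mem_iff_lt_rowLen, this]
  · exact fun h => absurd hμ h

theorem isSchurExpansion_unique {G : MvPowerSeries ℕ ℤ} {c c' : YoungDiagram →₀ ℤ}
    (hc : IsSchurExpansion G c) (hc' : IsSchurExpansion G c') : c = c' := by
  rw [← sub_eq_zero]
  apply eq_zero_of_sum_schur_eq_zero
  rw [Finsupp.sum_sub_index fun μ a b => sub_smul a b _, ← show G = _ from hc,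
    ← show G = _ from hc', sub_self]

end Uniqueness

/-! ### Farkas' lemma -/

section Farkas

open Finset

/-- Farkas' lemma over an ordered field: a vector is a nonnegative combination of finitely many
given vectors, or is separated from them by a linear functional. -/
theorem farkas {K V ι : Type*} [Field K] [LinearOrder K] [IsStrictOrderedRing K] [AddCommGroup V]
    [Module K V] (s : Finset ι) (a : ι → V) (b : V) :
    (∃ c : ι → K, (∀ i ∈ s, 0 ≤ c i) ∧ b = ∑ i ∈ s, c i • a i) ∨
      ∃ φ : V →ₗ[K] K, (∀ i ∈ s, 0 ≤ φ (a i)) ∧ φ b < 0 := by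
  classical
  induction s using Finset.induction_on generalizing a b with
  | empty =>
    by_cases hb : b = 0
    · exact Or.inl ⟨0, by simp, by simp [hb]⟩
    · obtain ⟨φ, hφ⟩ : ∃ φ : V →ₗ[K] K, φ b ≠ 0 := by
        by_contra! h
        exact hb ((Module.forall_dual_apply_eq_zero_iff K b).1 h)
      rcases lt_or_gt_of_ne hφ with h | h
      · exact Or.inr ⟨φ, by simp, h⟩
      · exact Or.inr ⟨-φ, by simp, by simpa using h⟩
  | insert j s hj ih =>
    rcases ih a b with ⟨c, hc, hb⟩ | ⟨φ, hφ, hφb⟩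
    · refine Or.inl ⟨Function.update c j 0, ?_, ?_⟩
      · intro i hi
        rcases eq_or_ne i j with rfl | hij
        · simp
        · rw [Function.update_of_ne hij]
          exact hc i (Finset.mem_of_mem_insert_of_ne hi hij)
      · rw [Finset.sum_insert hj, hb]
        simp only [Function.update_self, zero_smul, zero_add]
        refine Finset.sum_congr rfl fun i hi => ?_
        rw [Function.update_of_ne (ne_of_mem_of_not_mem hi hj)]
    · by_cases hφj : 0 ≤ φ (a j)
      · refine Or.inr ⟨φ, ?_, hφb⟩
        intro i hi
        rcases Finset.mem_insert.1 hi with rfl | hi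
        · exact hφj
        · exact hφ i hi
      · rw [not_le] at hφj
        -- project along `a j` to the kernel of `φ`
        let P : V →ₗ[K] V := LinearMap.id - (φ.smulRight ((φ (a j))⁻¹ • a j))
        have hP : ∀ x, P x = x - (φ x * (φ (a j))⁻¹) • a j := by
          intro x
          simp [P, mul_smul]
        rcases ih (fun i => P (a i)) (P b) with ⟨c, hc, hb⟩ | ⟨ψ, hψ, hψb⟩
        · refine Or.inl ⟨Function.update c j
            (φ b * (φ (a j))⁻¹ - ∑ i ∈ s, c i * (φ (a i) * (φ (a j))⁻¹)), ?_, ?_⟩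
          · intro i hi
            rcases eq_or_ne i j with rfl | hij
            · rw [Function.update_self]
              have h1 : 0 ≤ φ b * (φ (a i))⁻¹ :=
                mul_nonneg_of_nonpos_of_nonpos hφb.le (inv_nonpos.2 hφj.le)
              have h2 : ∑ k ∈ s, c k * (φ (a k) * (φ (a i))⁻¹) ≤ 0 :=
                Finset.sum_nonpos fun k hk => mul_nonpos_of_nonneg_of_nonpos (hc k hk)
                  (mul_nonpos_of_nonneg_of_nonpos (hφ k hk) (inv_nonpos.2 hφj.le))
              linarith
            · rw [Function.update_of_ne hij]
              exact hc i (Finset.mem_of_mem_insert_of_ne hi hij)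
          · rw [Finset.sum_insert hj, Function.update_self]
            have h1 : ∑ i ∈ s, Function.update c j
                (φ b * (φ (a j))⁻¹ - ∑ i ∈ s, c i * (φ (a i) * (φ (a j))⁻¹)) i • a i =
                ∑ i ∈ s, c i • a i := Finset.sum_congr rfl fun i hi => by
              rw [Function.update_of_ne (ne_of_mem_of_not_mem hi hj)]
            rw [h1]
            simp only [hP, smul_sub, Finset.sum_sub_distrib, smul_smul] at hb
            rw [← Finset.sum_smul] at hb
            rw [sub_smul]
            refine (sub_eq_iff_eq_add.1 hb).trans ?_
            abel
        · refine Or.inr ⟨ψ ∘ₗ P, ?_, hψb⟩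
          intro i hi
          rcases Finset.mem_insert.1 hi with rfl | hi
          · have : P (a i) = 0 := by rw [hP, mul_inv_cancel₀ hφj.ne, one_smul, sub_self]
            simp [this]
          · exact hψ i hi

end Farkas

/-! ### Recursions for the symmetric functions in the free ring -/

section Generators

open Finset

variable {N : ℕ}

/-- The generators of the free ring as a sequence indexed by `ℕ`, extended by zero. -/
noncomputable def gen (N i : ℕ) : FreeRing N := if h : i < N then u ⟨i, h⟩ else 0

@[simp] theorem gen_coe (a : Fin N) : gen N a = u a := by simp [gen]

theorem seqElem_succ_eq_sum {R : Type*} [Ring R] (v : ℕ → R) (m k : ℕ) :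
    seqElem v m (k + 1) = ∑ i ∈ range m, v i * seqElem v i k := by
  induction m with
  | zero => simp
  | succ m ih => rw [seqElem_succ_succ, ih, Finset.sum_range_succ]

theorem seqHomog_succ_eq_sum {R : Type*} [Ring R] (v : ℕ → R) (m l : ℕ) :
    seqHomog v m (l + 1) = ∑ i ∈ range m, seqHomog v (i + 1) l * v i := by
  induction m with
  | zero => simp
  | succ m ih => rw [seqHomog_succ_succ, ih, Finset.sum_range_succ]

theorem sum_filter_lt_eq_sum_range {M : Type*} [AddCommMonoid M] {m : ℕ} (hm : m ≤ N) (G : ℕ → M) :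
    ∑ a ∈ Finset.univ.filter (fun a : Fin N => (a : ℕ) < m), G a = ∑ i ∈ range m, G i := by
  refine Finset.sum_bij (fun a _ => (a : ℕ)) ?_ ?_ ?_ ?_
  · intro a ha
    simpa using ha
  · intro a _ b _ h
    exact Fin.ext h
  · intro i hi
    have := mem_range.1 hi
    exact ⟨⟨i, by omega⟩, by simpa using this, rfl⟩
  · intro a _
    rfl

theorem mono_ofList_cons (a : Fin N) (l : List (Fin N)) :
    mono (FreeMonoid.ofList (a :: l)) = u a * mono (FreeMonoid.ofList l) := by
  rw [FreeMonoid.ofList_cons, mono, map_mul]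
  rfl

theorem mono_ofList_concat (a : Fin N) (l : List (Fin N)) :
    mono (FreeMonoid.ofList (l ++ [a])) = mono (FreeMonoid.ofList l) * u a := by
  rw [FreeMonoid.ofList_append, mono, map_mul]
  rfl

theorem strictAnti_cons_iff {k : ℕ} (a : Fin N) (f : Fin k → Fin N) :
    StrictAnti (Fin.cons a f : Fin (k + 1) → Fin N) ↔ StrictAnti f ∧ ∀ i, f i < a := by
  constructor
  · intro h
    refine ⟨fun i j hij => ?_, fun i => ?_⟩
    · simpa using h (Fin.succ_lt_succ_iff.2 hij)
    · simpa using h (Fin.succ_pos i)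
  · rintro ⟨h1, h2⟩ i j hij
    induction j using Fin.cases with
    | zero => exact absurd hij (Fin.not_lt_zero i)
    | succ j =>
      induction i using Fin.cases with
      | zero => simpa using h2 j
      | succ i => simpa using h1 (Fin.succ_lt_succ_iff.1 hij)

theorem monotone_snoc_iff {k : ℕ} (a : Fin N) (f : Fin k → Fin N) :
    Monotone (Fin.snoc f a : Fin (k + 1) → Fin N) ↔ Monotone f ∧ ∀ i, f i ≤ a := by
  constructor
  · intro h
    refine ⟨fun i j hij => ?_, fun i => ?_⟩
    · simpa using h (Fin.castSucc_le_castSucc_iff.2 hij)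
    · simpa using h (Fin.castSucc_lt_last i).le
  · rintro ⟨h1, h2⟩ i j hij
    induction i using Fin.lastCases with
    | last =>
      rw [Fin.last_le_iff.1 hij]
    | cast i =>
      induction j using Fin.lastCases with
      | last => simpa using h2 i
      | cast j => simpa using h1 (Fin.castSucc_le_castSucc_iff.1 hij)

open Classical in
theorem sum_strictAnti_lt_eq_seqElem (m k : ℕ) (hm : m ≤ N) :
    ∑ f ∈ Finset.univ.filter (fun f : Fin k → Fin N => StrictAnti f ∧ ∀ i, (f i : ℕ) < m),
      mono (FreeMonoid.ofList (List.ofFn f)) = seqElem (gen N) m k := by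
  induction k generalizing m with
  | zero =>
    rw [Finset.filter_true_of_mem fun f _ => ⟨Subsingleton.strictAnti f, fun i => i.elim0⟩]
    simp [mono, MonoidAlgebra.one_def]
  | succ k ih =>
    rw [seqElem_succ_eq_sum, ← sum_filter_lt_eq_sum_range hm, Finset.sum_filter, Finset.sum_filter,
      ← (Fin.consEquiv fun _ => Fin N).sum_comp, Fintype.sum_prod_type]
    refine Finset.sum_congr rfl fun a _ => ?_
    rw [gen_coe, ← ih a a.2.le, Finset.sum_filter, Finset.mul_sum]
    by_cases ha : (a : ℕ) < m
    · rw [if_pos ha]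
      refine Finset.sum_congr rfl fun f _ => ?_
      have hiff : (StrictAnti (Fin.cons a f : Fin (k + 1) → Fin N) ∧
          ∀ i, ((Fin.cons a f : Fin (k + 1) → Fin N) i : ℕ) < m) ↔
          (StrictAnti f ∧ ∀ i, (f i : ℕ) < a) := by
        rw [strictAnti_cons_iff, Fin.forall_fin_succ]
        simp only [Fin.cons_zero, Fin.cons_succ]
        exact ⟨fun h => h.1, fun h => ⟨h, ha, fun i => (h.2 i).trans ha⟩⟩
      have he : (Fin.consEquiv fun _ => Fin N) (a, f) = (Fin.cons a f : Fin (k + 1) → Fin N) := rfl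
      rw [he, if_congr hiff rfl rfl, mul_ite, mul_zero, List.ofFn_cons, mono_ofList_cons]
    · rw [if_neg ha]
      refine Finset.sum_eq_zero fun f _ => if_neg fun h => ha ?_
      simpa using h.2 0

open Classical in
theorem sum_monotone_lt_eq_seqHomog (m l : ℕ) (hm : m ≤ N) :
    ∑ f ∈ Finset.univ.filter (fun f : Fin l → Fin N => Monotone f ∧ ∀ i, (f i : ℕ) < m),
      mono (FreeMonoid.ofList (List.ofFn f)) = seqHomog (gen N) m l := by
  induction l generalizing m with
  | zero =>
    rw [Finset.filter_true_of_mem fun f _ => ⟨Subsingleton.monotone f, fun i => i.elim0⟩]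
    simp [mono, MonoidAlgebra.one_def]
  | succ l ih =>
    rw [seqHomog_succ_eq_sum, ← sum_filter_lt_eq_sum_range hm, Finset.sum_filter,
      Finset.sum_filter, ← (Fin.snocEquiv fun _ => Fin N).sum_comp, Fintype.sum_prod_type]
    refine Finset.sum_congr rfl fun a _ => ?_
    rw [gen_coe, ← ih (a + 1) a.2, Finset.sum_filter, Finset.sum_mul]
    by_cases ha : (a : ℕ) < m
    · rw [if_pos ha]
      refine Finset.sum_congr rfl fun f _ => ?_
      have hiff : (Monotone (Fin.snoc f a : Fin (l + 1) → Fin N) ∧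
          ∀ i, ((Fin.snoc f a : Fin (l + 1) → Fin N) i : ℕ) < m) ↔
          (Monotone f ∧ ∀ i, (f i : ℕ) < a + 1) := by
        rw [monotone_snoc_iff, Fin.forall_fin_succ']
        simp only [Fin.snoc_castSucc, Fin.snoc_last, Nat.lt_succ_iff, Fin.le_def]
        exact ⟨fun h => h.1, fun h => ⟨h, fun i => (h.2 i).trans_lt ha, ha⟩⟩
      have he : (Fin.snocEquiv fun _ => Fin N) (a, f) = (Fin.snoc f a : Fin (l + 1) → Fin N) := rfl
      rw [he, if_congr hiff rfl rfl, ite_mul, zero_mul, List.ofFn_succ']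
      simp only [Fin.snoc_castSucc, Fin.snoc_last, List.concat_eq_append, mono_ofList_concat]
    · rw [if_neg ha]
      refine Finset.sum_eq_zero fun f _ => if_neg fun h => ha ?_
      simpa using h.2 (Fin.last l)

theorem elemNat_eq_seqElem (N k : ℕ) : elemNat N k = seqElem (gen N) N k := by
  classical
  rw [← sum_strictAnti_lt_eq_seqElem N k le_rfl, elemNat]
  refine Finset.sum_congr (Finset.filter_congr fun f _ => ?_) fun _ _ => rfl
  exact ⟨fun h => ⟨h, fun i => (f i).2⟩, fun h => h.1⟩

theorem homog_eq_seqHomog (N l : ℕ) : homog N l = seqHomog (gen N) N l := by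
  classical
  rw [← sum_monotone_lt_eq_seqHomog N l le_rfl, homog]
  refine Finset.sum_congr (Finset.filter_congr fun f _ => ?_) fun _ _ => rfl
  exact ⟨fun h => ⟨h, fun i => (f i).2⟩, fun h => h.1⟩

theorem map_seqElem {R S : Type*} [Ring R] [Ring S] (q : R →+* S) (v : ℕ → R) (m k : ℕ) :
    q (seqElem v m k) = seqElem (fun i => q (v i)) m k := by
  induction m generalizing k with
  | zero => cases k <;> simp
  | succ m ih => cases k <;> simp [seqElem_succ_succ, ih]

theorem map_seqHomog {R S : Type*} [Ring R] [Ring S] (q : R →+* S) (v : ℕ → R) (m l : ℕ) :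
    q (seqHomog v m l) = seqHomog (fun i => q (v i)) m l := by
  induction m generalizing l with
  | zero => cases l <;> simp
  | succ m ih =>
    induction l with
    | zero => simp
    | succ l ihl => rw [seqHomog_succ_succ, seqHomog_succ_succ, map_add, map_mul, ih, ihl]

/-- A ring homomorphism that kills `I_C` sends the generators to a sequence satisfying the
relations behind the commutation of the noncommutative elementary symmetric functions. -/
theorem satisfiesRelationsC_map_gen {R : Type*} [Ring R] (q : FreeRing N →+* R)
    (hq : ∀ z ∈ idealC N, q z = 0) : SatisfiesRelationsC fun i => q (gen N i) := by
  have h1 : ∀ a b : Fin N, a < b → _ := fun a b hab =>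
    hq _ (TwoSidedIdeal.subset_span (Or.inl (Or.inl ⟨a, b, hab, rfl⟩)))
  have h2 : ∀ a b c : Fin N, a < b → b < c → _ := fun a b c hab hbc =>
    hq _ (TwoSidedIdeal.subset_span (Or.inl (Or.inr ⟨a, b, c, hab, hbc, rfl⟩)))
  have h3 : ∀ a b c : Fin N, a < b → b < c → _ := fun a b c hab hbc =>
    hq _ (TwoSidedIdeal.subset_span (Or.inr ⟨a, b, c, hab, hbc, rfl⟩))
  simp only [map_sub, map_add, map_mul, map_pow] at h1 h2 h3
  have hgen : ∀ i (h : i < N), gen N i = u ⟨i, h⟩ := fun i h => by simp [gen, h]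
  have hgen0 : ∀ i, ¬ i < N → gen N i = 0 := fun i h => by simp [gen, h]
  constructor
  · intro a b hab
    by_cases hb : b < N
    · have h := h1 ⟨a, by omega⟩ ⟨b, hb⟩ hab
      simp only [hgen a (by omega), hgen b hb]
      rw [← sub_eq_zero, ← neg_eq_zero, ← h]
      noncomm_ring
    · simp [hgen0 b hb]
  · intro a b c hab hbc
    by_cases hc : c < N
    · have h := h2 ⟨a, by omega⟩ ⟨b, by omega⟩ ⟨c, hc⟩ hab hbc
      simp only [hgen a (by omega), hgen b (by omega), hgen c hc]
      rw [← sub_eq_zero, ← neg_eq_zero, ← h]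
      noncomm_ring
    · simp [hgen0 c hc]
  · intro a b c hab hbc
    by_cases hc : c < N
    · have h := h3 ⟨a, by omega⟩ ⟨b, by omega⟩ ⟨c, hc⟩ hab hbc
      simp only [hgen a (by omega), hgen b (by omega), hgen c hc]
      rw [← h]
      noncomm_ring
    · simp [hgen0 c hc]

end Generators

/-! ### The Schur expansion of `F γ` -/

section Commutative

open Finset

open scoped IsMulCommutative in
/-- Pairwise commuting elements `e k`, together with the elements `h l` determined by them through
`H(x) E(-x) = 1`, lie in a commutative ring. -/
theorem exists_commRing_lift {R : Type*} [Ring R] (e h : ℕ → R)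
    (hcomm : ∀ k l, e k * e l = e l * e k) (he0 : e 0 = 1)
    (hh : ∀ n, ∑ p ∈ Finset.HasAntidiagonal.antidiagonal n, h p.1 * ((-1) ^ p.2 * e p.2) =
      if n = 0 then 1 else 0) :
    ∃ S : Subring R, ∃ _ : IsMulCommutative S, ∃ e' h' : ℕ → S,
      (∀ k, (e' k : R) = e k) ∧ ∀ l, (h' l : R) = h l := by
  have hS := Subring.isMulCommutative_closure (s := Set.range e) (by
    rintro _ ⟨k, rfl⟩ _ ⟨l, rfl⟩
    exact hcomm k l)
  have he : ∀ k, e k ∈ Subring.closure (Set.range e) := fun k => Subring.subset_closure ⟨k, rfl⟩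
  have hmem : ∀ l, h l ∈ Subring.closure (Set.range e) := by
    intro l
    induction l using Nat.strong_induction_on with
    | _ l ih =>
      have h1 := hh l
      rw [Finset.Nat.sum_antidiagonal_eq_sum_range_succ_mk, Finset.sum_range_succ] at h1
      simp only [Nat.sub_self, pow_zero, he0, mul_one] at h1
      rw [eq_sub_of_add_eq' h1]
      refine Subring.sub_mem _ ?_ (Subring.sum_mem _ fun k hk => ?_)
      · split_ifs
        · exact Subring.one_mem _
        · exact Subring.zero_mem _
      · exact Subring.mul_mem _ (ih k (mem_range.1 hk)) (Subring.mul_mem _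
          (Subring.pow_mem _ (Subring.neg_mem _ (Subring.one_mem _)) _) (he _))
  exact ⟨Subring.closure (Set.range e), hS, fun k => ⟨e k, he k⟩, fun l => ⟨h l, hmem l⟩,
    fun _ => rfl, fun _ => rfl⟩

/-- The determinant `schurDet`, written with ordered products. -/
theorem schurDet_eq_sum {A : Type*} [CommRing A] (e : ℤ → A) (μ : YoungDiagram) :
    schurDet e μ = ∑ π : Equiv.Perm (Fin (μ.rowLen 0)), (Equiv.Perm.sign π : ℤ) •
      (List.ofFn fun i : Fin (μ.rowLen 0) =>
        e ((μ.colLen i : ℤ) + ((π i : ℕ) : ℤ) - ((i : ℕ) : ℤ))).prod := by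
  rw [schurDet, kostkaDet, ← Matrix.det_transpose, Matrix.det_apply]
  refine Finset.sum_congr rfl fun π _ => ?_
  rw [List.prod_ofFn]
  rfl

open scoped IsMulCommutative in
/-- The noncommutative Cauchy identity modulo an ideal containing `I_C`. -/
theorem map_prod_homog {N : ℕ} {R : Type*} [Ring R] (q : FreeRing N →+* R)
    (hq : ∀ z ∈ idealC N, q z = 0) (n : ℕ) (α : ℕ →₀ ℕ) (hα : α.support ⊆ range n) :
    q ((List.range n).map fun j => homog N (α j)).prod =
      q (∑ μ ∈ diagramsOfCard (∑ j ∈ range n, α j), kostka μ α • ncSchur N μ) := by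
  have hsw := satisfiesRelationsC_map_gen q hq
  have hqe : ∀ k, q (elemNat N k) = seqElem (fun i => q (gen N i)) N k := fun k => by
    rw [elemNat_eq_seqElem, map_seqElem]
  have hqh : ∀ k, q (homog N k) = seqHomog (fun i => q (gen N i)) N k := fun k => by
    rw [homog_eq_seqHomog, map_seqHomog]
  obtain ⟨S, hS, e', h', he', hh'⟩ := exists_commRing_lift
    (seqElem (fun i => q (gen N i)) N) (seqHomog (fun i => q (gen N i)) N)
    (seqElem_commute _ hsw N) (by simp) (sum_seqHomog_mul_seqElem _ N)
  let e : ℤ → S := fun k => if 0 ≤ k then e' k.toNat else 0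
  have he : ∀ k, S.subtype (e k) = q (elem N k) := by
    intro k
    by_cases hk : 0 ≤ k
    · simp only [e, elem, if_pos hk]
      rw [hqe, ← he']
      rfl
    · simp only [e, elem, if_neg hk, map_zero]
  have hinj : Function.Injective S.subtype := Subtype.val_injective
  have key := prod_homog_eq_sum_kostka e h'
    (hinj (by simp [e, he']))
    (fun k hk => by simp [e, not_le.2 hk])
    (fun n => hinj (by
      have := sum_seqHomog_mul_seqElem (fun i => q (gen N i)) N n
      simp only [map_sum, map_mul, map_pow, map_neg, map_one, apply_ite S.subtype, map_zero]
      rw [← this]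
      refine Finset.sum_congr rfl fun p _ => ?_
      simp [e, he', hh'])) n α hα
  have hJ : ∀ μ, S.subtype (schurDet e μ) = q (ncSchur N μ) := by
    intro μ
    rw [schurDet_eq_sum, ncSchur, map_sum, map_sum]
    refine Finset.sum_congr rfl fun π _ => ?_
    rw [map_zsmul, map_zsmul, map_list_prod, map_list_prod, List.map_ofFn, List.map_ofFn]
    congr 3
    funext i
    exact he _
  have := congrArg S.subtype key
  rw [map_list_prod, List.map_map, map_sum] at this
  rw [map_list_prod, List.map_map, map_sum]
  convert this using 1
  · congr 2
    funext j
    simp only [Function.comp_apply]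
    rw [hqh, ← hh']
    rfl
  · refine Finset.sum_congr rfl fun μ _ => ?_
    rw [map_mul, map_natCast, hJ, map_nsmul, nsmul_eq_mul]

end Commutative

section Homogeneity

variable {N : ℕ}

/-- All words occurring in `f` have length `d`. The degree is an integer because the formula for
`ncSchur` involves `elem` at negative arguments. -/
def IsHomog (d : ℤ) (f : FreeRing N) : Prop := ∀ w, f.coeff w ≠ 0 → (w.length : ℤ) = d

theorem IsHomog.zero (d : ℤ) : IsHomog d (0 : FreeRing N) := fun _ h => absurd rfl h

theorem IsHomog.mono (w : FreeMonoid (Fin N)) : IsHomog w.length (mono w) := by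
  classical
  intro w' h
  rw [NCSchur.mono, MonoidAlgebra.of_apply, MonoidAlgebra.coeff_single, Finsupp.single_apply] at h
  have : w = w' := by
    by_contra hne
    exact h (if_neg hne)
  rw [this]

theorem IsHomog.sum {ι : Type*} {d : ℤ} (s : Finset ι) (f : ι → FreeRing N)
    (h : ∀ i ∈ s, IsHomog d (f i)) : IsHomog d (∑ i ∈ s, f i) := by
  intro w hw
  rw [MonoidAlgebra.coeff_sum, Finsupp.finsetSum_apply] at hw
  obtain ⟨i, hi, hne⟩ := Finset.exists_ne_zero_of_sum_ne_zero hw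
  exact h i hi w hne

theorem IsHomog.zsmul {d : ℤ} {f : FreeRing N} (h : IsHomog d f) (c : ℤ) : IsHomog d (c • f) := by
  intro w hw
  refine h w fun h0 => hw ?_
  rw [MonoidAlgebra.coeff_smul_apply, h0, smul_zero]

theorem IsHomog.mul {d d' : ℤ} {f g : FreeRing N} (hf : IsHomog d f) (hg : IsHomog d' g) :
    IsHomog (d + d') (f * g) := by
  classical
  intro w hw
  rw [MonoidAlgebra.coeff_mul, Finsupp.sum] at hw
  obtain ⟨w1, h1, hne⟩ := Finset.exists_ne_zero_of_sum_ne_zero hw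
  rw [Finsupp.sum] at hne
  obtain ⟨w2, h2, hne⟩ := Finset.exists_ne_zero_of_sum_ne_zero hne
  have hw12 : w1 * w2 = w := by
    by_contra h
    exact hne (if_neg h)
  rw [← hw12, FreeMonoid.length_mul, Nat.cast_add, hf w1 (Finsupp.mem_support_iff.1 h1),
    hg w2 (Finsupp.mem_support_iff.1 h2)]

theorem IsHomog.list_prod_ofFn {n : ℕ} (d : Fin n → ℤ) (f : Fin n → FreeRing N)
    (h : ∀ i, IsHomog (d i) (f i)) : IsHomog (∑ i, d i) (List.ofFn f).prod := by
  induction n with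
  | zero =>
    have := IsHomog.mono (1 : FreeMonoid (Fin N))
    simpa [NCSchur.mono, MonoidAlgebra.one_def] using this
  | succ n ih =>
    rw [Fin.sum_univ_succ, List.ofFn_succ, List.prod_cons]
    exact (h 0).mul (ih _ _ fun i => h i.succ)

theorem isHomog_elem (N : ℕ) (k : ℤ) : IsHomog k (elem N k) := by
  rw [elem]
  split_ifs with hk
  · rw [elemNat]
    refine IsHomog.sum _ _ fun f _ => ?_
    have := IsHomog.mono (FreeMonoid.ofList (List.ofFn f))
    have hlen : ((FreeMonoid.ofList (List.ofFn f)).length : ℤ) = k := by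
      have : (FreeMonoid.ofList (List.ofFn f)).length = (List.ofFn f).length := rfl
      rw [this, List.length_ofFn]
      omega
    rwa [hlen] at this
  · exact IsHomog.zero k

theorem isHomog_ncSchur (N : ℕ) (μ : YoungDiagram) : IsHomog μ.card (ncSchur N μ) := by
  refine IsHomog.sum _ _ fun π _ => IsHomog.zsmul ?_ _
  have h := IsHomog.list_prod_ofFn
    (fun i : Fin (μ.rowLen 0) => (μ.colLen i : ℤ) + ((π i : ℕ) : ℤ) - ((i : ℕ) : ℤ)) _
    fun i => isHomog_elem N _
  have hsum : ∑ i : Fin (μ.rowLen 0), ((μ.colLen i : ℤ) + ((π i : ℕ) : ℤ) - ((i : ℕ) : ℤ)) =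
      μ.card := by
    rw [Finset.sum_sub_distrib, Finset.sum_add_distrib,
      Equiv.sum_comp π (fun i => ((i : ℕ) : ℤ)), add_sub_cancel_right,
      Fin.sum_univ_eq_sum_range (fun i => (μ.colLen i : ℤ)), card_eq_sum_colLen le_rfl,
      Nat.cast_sum]
  rwa [hsum] at h

end Homogeneity

section Pairing

variable {N : ℕ}

theorem pairing_eq_sum (f : FreeRing N) (γ : WordModule N) :
    pairing f γ = ∑ w ∈ γ.support, f.coeff w * γ w := rfl

/-- The pairing with a fixed `γ` as a homomorphism. -/
def pairingHom (γ : WordModule N) : FreeRing N →+ ℤ where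
  toFun f := pairing f γ
  map_zero' := by simp [pairing_eq_sum]
  map_add' f g := by simp [pairing_eq_sum, add_mul, Finset.sum_add_distrib]

theorem pairingHom_apply (γ : WordModule N) (f : FreeRing N) : pairingHom γ f = pairing f γ := rfl

theorem pairing_eq_of_sub_mem {I : TwoSidedIdeal (FreeRing N)} {γ : WordModule N} (hγ : γ ∈ perp I)
    {f g : FreeRing N} (h : f - g ∈ I) : pairing f γ = pairing g γ := by
  have := hγ _ h
  rwa [← pairingHom_apply, map_sub, sub_eq_zero] at this

open Classical in
/-- The coefficients of the Schur expansion of `F γ`. -/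
noncomputable def schurCoeff (γ : WordModule N) : YoungDiagram →₀ ℤ :=
  Finsupp.onFinset (γ.support.biUnion fun w => diagramsOfCard w.length)
    (fun μ => pairing (ncSchur N μ) γ) fun μ hμ => by
      rw [pairing_eq_sum] at hμ
      obtain ⟨w, hw, hne⟩ := Finset.exists_ne_zero_of_sum_ne_zero hμ
      have := isHomog_ncSchur N μ w (left_ne_zero_of_mul hne)
      simp only [Finset.mem_biUnion, mem_diagramsOfCard]
      exact ⟨w, hw, by exact_mod_cast this.symm⟩

@[simp] theorem schurCoeff_apply (γ : WordModule N) (μ : YoungDiagram) :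
    schurCoeff γ μ = pairing (ncSchur N μ) γ := rfl

/-- For `γ` orthogonal to an ideal containing `I_C`, the coefficient of `s_λ` in `F γ` is
`⟨𝔍_λ, γ⟩`. -/
theorem isSchurExpansion_schurCoeff {I : TwoSidedIdeal (FreeRing N)} (hC : idealC N ≤ I)
    {γ : WordModule N} (hγ : γ ∈ perp I) : IsSchurExpansion (F γ) (schurCoeff γ) := by
  classical
  funext α
  set n := α.support.sup id + 1 with hn
  have hα : α.support ⊆ Finset.range n := fun x hx =>
    Finset.mem_range.2 (Nat.lt_succ_of_le (Finset.le_sup (f := id) hx))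
  have hq : ∀ z, z ∈ I ↔ I.ringCon.mk' z = 0 := fun z => by
    rw [← TwoSidedIdeal.mem_ker, TwoSidedIdeal.ker_ringCon_mk']
  have hcauchy := map_prod_homog I.ringCon.mk' (fun z hz => (hq z).1 (hC hz)) n α hα
  rw [← sub_eq_zero, ← map_sub, ← hq] at hcauchy
  rw [sum_schur_apply]
  change pairing (MvPowerSeries.coeff α (partialCauchy N n)) γ = _
  rw [coeff_partialCauchy, if_pos hα, pairing_eq_of_sub_mem hγ hcauchy, ← pairingHom_apply, map_sum]
  set D := diagramsOfCard (∑ j ∈ Finset.range n, α j)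
  calc _ = ∑ μ ∈ D, schurCoeff γ μ * (kostka μ α : ℤ) := by
        refine Finset.sum_congr rfl fun μ _ => ?_
        rw [map_nsmul, pairingHom_apply, schurCoeff_apply, nsmul_eq_mul, mul_comm]
    _ = ∑ μ ∈ D ∪ (schurCoeff γ).support, schurCoeff γ μ * (kostka μ α : ℤ) := by
        refine Finset.sum_subset Finset.subset_union_left fun μ _ hμ => ?_
        rw [kostka_eq_zero hα fun h => hμ (mem_diagramsOfCard.2 h), Nat.cast_zero, mul_zero]
    _ = _ := by
        symm
        refine Finset.sum_subset Finset.subset_union_right fun μ _ hμ => ?_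
        rw [Finsupp.notMem_support_iff.1 hμ, zero_mul]

end Pairing

/-! ### Duality between monomial positivity and pairings -/

section Duality

variable {N : ℕ}

instance (N d : ℕ) : Finite {w : FreeMonoid (Fin N) // w.length = d} :=
  (List.finite_length_eq (Fin N) d).to_subtype

/-- The coefficients of `f` at the words of length `d`, as rational numbers. -/
def degreeCoeff (N d : ℕ) : FreeRing N →+ ({w : FreeMonoid (Fin N) // w.length = d} → ℚ) where
  toFun f w := f.coeff w.1
  map_zero' := by funext w; simp
  map_add' f g := by funext w; simp

theorem degreeCoeff_apply {d : ℕ} (f : FreeRing N) (w : {w : FreeMonoid (Fin N) // w.length = d}) :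
    degreeCoeff N d f w = f.coeff w.1 := rfl

/-- Denominators can be cleared in the rational span of an ideal. -/
theorem exists_smul_eq_degreeCoeff (I : TwoSidedIdeal (FreeRing N)) (d : ℕ)
    {x : {w : FreeMonoid (Fin N) // w.length = d} → ℚ}
    (hx : x ∈ Submodule.span ℚ (degreeCoeff N d '' (I : Set (FreeRing N)))) :
    ∃ m : ℕ, 0 < m ∧ ∃ z ∈ I, (m : ℚ) • x = degreeCoeff N d z := by
  induction hx using Submodule.span_induction with
  | mem x hx =>
    obtain ⟨z, hz, rfl⟩ := hx
    exact ⟨1, one_pos, z, hz, by simp⟩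
  | zero => exact ⟨1, one_pos, 0, I.zero_mem, by simp⟩
  | add x y _ _ hx hy =>
    obtain ⟨m, hm, z, hz, hxz⟩ := hx
    obtain ⟨m', hm', z', hz', hyz⟩ := hy
    refine ⟨m * m', Nat.mul_pos hm hm', m' • z + m • z',
      I.add_mem (I.nsmul_mem _ hz) (I.nsmul_mem _ hz'), ?_⟩
    rw [map_add, map_nsmul, map_nsmul, ← hxz, ← hyz, ← Nat.cast_smul_eq_nsmul ℚ,
      ← Nat.cast_smul_eq_nsmul ℚ, smul_smul, smul_smul, smul_add, Nat.cast_mul, mul_comm (m : ℚ)]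
  | smul a x _ hx =>
    obtain ⟨m, hm, z, hz, hxz⟩ := hx
    refine ⟨a.den * m, Nat.mul_pos a.den_pos hm, a.num • z, I.zsmul_mem _ hz, ?_⟩
    rw [map_zsmul, ← hxz, ← Int.cast_smul_eq_zsmul ℚ, smul_smul, smul_smul]
    congr 1
    rw [← Rat.den_mul_eq_num a]
    push_cast
    ring

/-- Finitely many rational numbers have a common denominator. -/
theorem exists_common_denominator {ι : Type*} [Finite ι] (g : ι → ℚ) :
    ∃ m : ℕ, 0 < m ∧ ∃ n : ι → ℤ, ∀ i, (n i : ℚ) = m * g i := by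
  have := Fintype.ofFinite ι
  refine ⟨∏ i, (g i).den, Finset.prod_pos fun i _ => (g i).den_pos, ?_⟩
  have h : ∀ i, ∃ n : ℤ, (n : ℚ) = ((∏ i, (g i).den : ℕ) : ℚ) * g i := by
    intro i
    obtain ⟨k, hk⟩ := Finset.dvd_prod_of_mem (fun i => (g i).den) (Finset.mem_univ i)
    refine ⟨k * (g i).num, ?_⟩
    rw [hk, Int.cast_mul, ← Rat.den_mul_eq_num]
    push_cast
    ring
  choose n hn using h
  exact ⟨n, hn⟩

/-- The element of `𝒰^*` with given coefficients at the words of length `d`. -/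
noncomputable def wordsOfDegree {d : ℕ} (n : {w : FreeMonoid (Fin N) // w.length = d} → ℤ) :
    WordModule N :=
  Finsupp.embDomain (Function.Embedding.subtype _) (Finsupp.equivFunOnFinite.symm n)

theorem pairing_wordsOfDegree {d : ℕ} [Fintype {w : FreeMonoid (Fin N) // w.length = d}]
    (f : FreeRing N) (n : {w : FreeMonoid (Fin N) // w.length = d} → ℤ) :
    pairing f (wordsOfDegree n) = ∑ w, f.coeff w.1 * n w := by
  rw [pairing, wordsOfDegree, Finsupp.sum_embDomain, Finsupp.sum_fintype _ _ fun _ => mul_zero _]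
  rfl

theorem wordsOfDegree_mem_wordCone {d : ℕ} {n : {w : FreeMonoid (Fin N) // w.length = d} → ℤ}
    (hn : ∀ w, 0 ≤ n w) : wordsOfDegree n ∈ wordCone N := by
  intro w
  by_cases hw : w.length = d
  · have : wordsOfDegree n w = n ⟨w, hw⟩ :=
      Finsupp.embDomain_apply_self
        (Function.Embedding.subtype fun w : FreeMonoid (Fin N) => w.length = d) _ ⟨w, hw⟩
    rw [this]
    exact hn _
  · have : wordsOfDegree n w = 0 := by
      refine Finsupp.embDomain_of_notMem_range _ _ _ ?_
      rintro ⟨w', rfl⟩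
      exact hw w'.2
    rw [this]

theorem coeff_component (d : ℕ) (f : FreeRing N) (w : FreeMonoid (Fin N)) :
    (component d f).coeff w = if w.length = d then f.coeff w else 0 := by
  rw [component, MonoidAlgebra.coeff_ofCoeff, Finsupp.filter_apply]

/-- For a homogeneous element, monomial positivity modulo a homogeneous ideal `I` is dual to
nonnegativity of the pairing on the cone of nonnegative elements of `I^⊥`. -/
theorem isQMonomialPositive_iff {I : TwoSidedIdeal (FreeRing N)} (hI : IsHomogeneousIdeal I) {d : ℕ}
    {f : FreeRing N} (hf : IsHomog d f) :
    (∀ γ ∈ wordCone N ∩ perp I, 0 ≤ pairing f γ) ↔ IsQMonomialPositive I f := by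
  classical
  constructor
  · intro h
    have := Fintype.ofFinite {w : FreeMonoid (Fin N) // w.length = d}
    set L := Submodule.span ℚ (degreeCoeff N d '' (I : Set (FreeRing N))) with hL
    have hsum : ∀ x : {w : FreeMonoid (Fin N) // w.length = d} → ℚ,
        L.mkQ x = ∑ w, x w • L.mkQ (Pi.single w 1) := by
      intro x
      rw [← Finset.univ_sum_single x, map_sum]
      refine Finset.sum_congr rfl fun w _ => ?_
      rw [← map_smul, ← Pi.single_smul, smul_eq_mul, mul_one, Finset.univ_sum_single]
    rcases farkas (K := ℚ) Finset.univ (fun w => L.mkQ (Pi.single w 1))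
      (L.mkQ (degreeCoeff N d f)) with ⟨c, hc, hb⟩ | ⟨φ, hφ, hφf⟩
    · rw [← hsum c, ← sub_eq_zero, ← map_sub, Submodule.mkQ_apply,
        Submodule.Quotient.mk_eq_zero] at hb
      obtain ⟨m, hm, z, hz, hmz⟩ := exists_smul_eq_degreeCoeff I d hb
      refine ⟨m, hm, m • f - component d z, ?_, component d z, hI z hz d, by abel⟩
      intro w
      rw [MonoidAlgebra.coeff_sub, Finsupp.sub_apply, MonoidAlgebra.coeff_smul_apply,
        coeff_component]
      split_ifs with hw
      · have h1 := congrFun hmz ⟨w, hw⟩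
        simp only [Pi.smul_apply, Pi.sub_apply, degreeCoeff_apply, smul_eq_mul] at h1
        have h2 : 0 ≤ (m : ℚ) * c ⟨w, hw⟩ :=
          mul_nonneg (Nat.cast_nonneg m) (hc _ (Finset.mem_univ _))
        have h3 : (0 : ℚ) ≤ m * f.coeff w - z.coeff w := by linarith
        rw [nsmul_eq_mul]
        exact_mod_cast h3
      · have h0 : f.coeff w = 0 := by
          by_contra hne
          exact hw (by exact_mod_cast hf w hne)
        simp [h0]
    · -- the separating functional, with denominators cleared, is the forbidden `γ`
      exfalso
      obtain ⟨m, hm, n, hn⟩ := exists_common_denominator fun w => φ (L.mkQ (Pi.single w 1))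
      have hpair : ∀ g : FreeRing N,
          ((pairing g (wordsOfDegree n) : ℤ) : ℚ) = m * φ (L.mkQ (degreeCoeff N d g)) := by
        intro g
        rw [pairing_wordsOfDegree, hsum, map_sum, Finset.mul_sum, Int.cast_sum]
        refine Finset.sum_congr rfl fun w _ => ?_
        rw [Int.cast_mul, hn, map_smul, smul_eq_mul, degreeCoeff_apply]
        ring
      have hm' : (0 : ℚ) < m := Nat.cast_pos.2 hm
      have hpos : wordsOfDegree n ∈ wordCone N := wordsOfDegree_mem_wordCone fun w => by
        have : (0 : ℚ) ≤ n w := by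
          rw [hn]
          exact mul_nonneg hm'.le (hφ w (Finset.mem_univ w))
        exact_mod_cast this
      have hperp : wordsOfDegree n ∈ perp I := by
        intro z hz
        have h1 := hpair z
        have h2 : L.mkQ (degreeCoeff N d z) = 0 := by
          rw [Submodule.mkQ_apply, Submodule.Quotient.mk_eq_zero]
          exact Submodule.subset_span ⟨z, hz, rfl⟩
        rw [h2, map_zero, mul_zero] at h1
        exact_mod_cast h1
      have h1 := h _ ⟨hpos, hperp⟩
      have h2 : (0 : ℚ) ≤ (pairing f (wordsOfDegree n) : ℤ) := by exact_mod_cast h1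
      rw [hpair] at h2
      exact absurd h2 (not_le.2 (mul_neg_of_pos_of_neg hm' hφf))
  · rintro ⟨m, hm, p, hp, z, hz, hfp⟩ γ ⟨hγ, hγI⟩
    have h1 := congrArg (pairingHom γ) hfp
    rw [map_add, map_nsmul, pairingHom_apply, pairingHom_apply, pairingHom_apply, hγI z hz,
      add_zero, nsmul_eq_mul] at h1
    have h2 : 0 ≤ pairing p γ := Finset.sum_nonneg fun w _ => mul_nonneg (hp w) (hγ w)
    rw [← h1] at h2
    exact nonneg_of_mul_nonneg_right h2 (by exact_mod_cast hm)

end Duality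

end NCSchur

theorem theorem2p6 (N : ℕ) (I : TwoSidedIdeal (NCSchur.FreeRing N))
    (hI : NCSchur.IsHomogeneousIdeal I) (hC : NCSchur.idealC N ≤ I) :
    -- the Schur expansion, hence each of its coefficients, exists and is unique
    (∀ γ ∈ NCSchur.perp I,
      ∃! c : YoungDiagram →₀ ℤ, NCSchur.IsSchurExpansion (NCSchur.F γ) c) ∧
    -- all partitions at once
    ((∀ γ ∈ NCSchur.wordCone N ∩ NCSchur.perp I, NCSchur.IsSchurPositive (NCSchur.F γ)) ↔
      ∀ μ : YoungDiagram, NCSchur.IsQMonomialPositive I (NCSchur.ncSchur N μ)) ∧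
    -- each partition separately
    (∀ μ : YoungDiagram,
      (∀ γ ∈ NCSchur.wordCone N ∩ NCSchur.perp I, ∀ c : YoungDiagram →₀ ℤ,
        NCSchur.IsSchurExpansion (NCSchur.F γ) c → 0 ≤ c μ) ↔
      NCSchur.IsQMonomialPositive I (NCSchur.ncSchur N μ)) := by
  have hexp : ∀ γ ∈ NCSchur.perp I,
      NCSchur.IsSchurExpansion (NCSchur.F γ) (NCSchur.schurCoeff γ) := fun γ hγ =>
    NCSchur.isSchurExpansion_schurCoeff hC hγ
  have hdual := fun μ => NCSchur.isQMonomialPositive_iff hI (NCSchur.isHomog_ncSchur N μ)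
  refine ⟨fun γ hγ => ⟨_, hexp γ hγ, fun c hc => NCSchur.isSchurExpansion_unique hc (hexp γ hγ)⟩,
    ⟨fun h μ => (hdual μ).1 fun γ hγ => ?_, fun h γ hγ => ?_⟩, fun μ => ?_⟩
  · obtain ⟨c, hc, hpos⟩ := h γ hγ
    rw [← NCSchur.schurCoeff_apply, NCSchur.isSchurExpansion_unique (hexp γ hγ.2) hc]
    exact hpos μ
  · exact ⟨_, hexp γ hγ.2, fun μ => (hdual μ).2 (h μ) γ hγ⟩
  · rw [← hdual μ]
    refine forall₂_congr fun γ hγ => ⟨fun h => h _ (hexp γ hγ.2), fun h c hc => ?_⟩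
    rw [NCSchur.isSchurExpansion_unique hc (hexp γ hγ.2)]
    exact h
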